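/- **Theorem 6.2.** For $K\in\{\mathbb R,\mathbb C\}$, call $f,g\in K[[x,y]]$ $K$-equivalent if $\phi(f)=g$ for some $K$-algebra automorphism $\phi$ of $K[[x,y]]$. Consider the normal forms $$\mathrm{NF}(J_{10}^{+}(a))=x^3+ax^2y^2+xy^4\quad(a^2\neq 4),\qquad \mathrm{NF}(J_{10}^{-}(a))=x^3+ax^2y^2-xy^4\quad(\text{no restriction on }a).$$ For $T_1,T_2\in\{J_{10}^+,J_{10}^-\}$ let $P_1(T_1,T_2)$ (resp. $P_2(T_1,T_2)$) be the set of pairs $(u,v)\in\mathbb C^2$ (resp. $(u,v)\in\mathbb R^2$) of parameters satisfying these restrictions such that $\mathrm{NF}(T_1(u))$ and $\mathrm{NF}(T_2(v))$ are $\mathbb C$-equivalent, and let $P_3(T_1,T_2)$ be the set of such pairs $(u,v)\in\mathbb R^2$ for which they are $\mathbb R$-equivalent. For $\Omega\subset\mathbb C$ write $\Gamma_\Omega(g_1,\dots,g_m)=\{(a,g_i(a)) : a\in\Omega,\ 1\le i\le m\}$. For $\rho,\sigma\in\{1,-1\}$ put, with principal square roots, $$f_1^{\rho,\sigma}(a)=\sqrt{\rho\sigma}\,a,\qquad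 f_2^{\rho,\sigma}(a)=-\sqrt{\rho\sigma}\,a,$$ $$f_{3}^{\rho,\sigma}(a)=-f_4^{\rho,\sigma}(a)=\sqrt{\frac{-\rho\sigma(a^2-4\rho)(a^2-9\rho)+a(a^2-3\rho)\sqrt{a^2-4\rho}}{2(a^2-4\rho)}},$$ $$f_{5}^{\rho,\sigma}(a)=-f_6^{\rho,\sigma}(a)=\sqrt{\frac{-\rho\sigma(a^2-4\rho)(a^2-9\rho)-a(a^2-3\rho)\sqrt{a^2-4\rho}}{2(a^2-4\rho)}}.$$ Let $\xi=\frac{3}{\sqrt2}$, $I_1=\,]\xi,\infty[$, $I_2=\,]2,\xi[$, $I_3=\,]-\xi,-2[$, $I_4=\,]-\infty,-\xi[$ (real intervals), $\mathbb C'=\mathbb C\setminus\{-2,2\}$, $\mathbb R'=\mathbb R\setminus\{-2,2\}$, $\mathbb C''=\mathbb C\setminus\{-2i,2i\}$. Below, $f_j=f_j^{\rho,\sigma}$ with $\rho=1$ if $T_1=J_{10}^+$, $\rho=-1$ if $T_1=J_{10}^-$, and $\sigma=1$ if $T_2=J_{10}^+$, $\sigma=-1$ if $T_2=J_{10}^-$.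 Then the following hold. 1. For $(T_1,T_2)=(J_{10}^+,J_{10}^+)$: $P_1=\Gamma_{\mathbb C'}(f_1,\dots,f_6)$; $P_2=\Gamma_{\mathbb R'}(f_1,f_2)\cup\Gamma_{\mathbb R^{>2}}(f_3,f_4)\cup\Gamma_{\mathbb R^{<-2}}(f_5,f_6)\cup\{(0,-\xi),(0,\xi)\}\cup\{(-\xi,0),(\xi,0)\}$; $P_3=\Gamma_{\mathbb R'}(f_1)\cup\Gamma_{\mathbb R^{>2}}(f_4)\cup\Gamma_{\mathbb R^{<-2}}(f_5)$. 2. For $(T_1,T_2)=(J_{10}^-,J_{10}^-)$: $P_1=\Gamma_{\mathbb C}(f_1,f_2)\cup\Gamma_{\mathbb C''}(f_3,f_4,f_5,f_6)$; $P_2=\Gamma_{\mathbb R}(f_1,f_2)$; $P_3=\Gamma_{\mathbb R}(f_1)$. 3. For $(T_1,T_2)=(J_{10}^+,J_{10}^-)$: $P_1=\Gamma_{\mathbb C'}(f_1,\dots,f_6)$; $P_2=\{(0,0)\}\cup\Gamma_{\mathbb R^{>2}}(f_3,f_4)\cup\Gamma_{\mathbb R^{<-2}}(f_5,f_6)$;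 $P_3=\Gamma_{I_1}(f_3)\cup\Gamma_{I_2}(f_4)\cup\Gamma_{I_3}(f_5)\cup\Gamma_{I_4}(f_6)\cup\{(-\xi,0),(\xi,0)\}$. 4. For $(T_1,T_2)=(J_{10}^-,J_{10}^+)$: $P_1=\Gamma_{\mathbb C''}(f_1,\dots,f_6)$; $P_2=\{(0,0)\}\cup\Gamma_{\mathbb R}(f_3,f_4,f_5,f_6)$; $P_3=\Gamma_{\mathbb R}(f_3,f_6)$. In particular, for every $a\in\mathbb R$ there is $a'\in\mathbb R$ with $a'^2\neq4$ such that $\mathrm{NF}(J_{10}^-(a))$ is $\mathbb R$-equivalent to $\mathrm{NF}(J_{10}^+(a'))$, so the subtype $J_{10}^-$ is redundant; the converse fails: there is $a'\in\mathbb R$ with $a'^2\ne4$ such that $\mathrm{NF}(J_{10}^+(a'))$ is not $\mathbb R$-equivalent to $\mathrm{NF}(J_{10}^-(a))$ for any $a\in\mathbb R$. -/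

import Mathlib

namespace J10

/-- The ring `K[[x, y]]` of formal power series in two variables. -/
abbrev PS (K : Type*) [Field K] : Type _ := MvPowerSeries (Fin 2) K

/-- The set of all `K`-algebra automorphisms `φ` of `K[[x, y]]` with `φ(f) = g`. -/
def transporter (K : Type*) [Field K] (f g : PS K) : Set (PS K ≃ₐ[K] PS K) :=
  {φ | φ f = g}

/-- `K`-equivalence (right equivalence) of two power series. -/
def KEquiv (K : Type*) [Field K] (f g : PS K) : Prop :=
  (transporter K f g).Nonempty

/-- The two real subtypes `J₁₀⁺` and `J₁₀⁻` of the singularity type `J₁₀`. -/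
inductive Subtypes : Type
  | plus : Subtypes
  | minus : Subtypes

/-- The normal forms `x³ + a x² y² + x y⁴` of `J₁₀⁺(a)` and `x³ + a x² y² - x y⁴` of `J₁₀⁻(a)`,
with `x = X 0` and `y = X 1`. -/
noncomputable def NF {K : Type*} [Field K] : Subtypes → K → PS K
  | .plus, a =>
      (MvPowerSeries.X 0) ^ 3 + a • ((MvPowerSeries.X 0) ^ 2 * (MvPowerSeries.X 1) ^ 2)
        + (MvPowerSeries.X 0) * (MvPowerSeries.X 1) ^ 4
  | .minus, a =>
      (MvPowerSeries.X 0) ^ 3 + a • ((MvPowerSeries.X 0) ^ 2 * (MvPowerSeries.X 1) ^ 2)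
        - (MvPowerSeries.X 0) * (MvPowerSeries.X 1) ^ 4

/-- The restriction on the parameter: `a² ≠ 4` for `J₁₀⁺(a)`, none for `J₁₀⁻(a)`. -/
def Admissible {K : Type*} [Field K] : Subtypes → K → Prop
  | .plus, a => a ^ 2 ≠ 4
  | .minus, _ => True

/-- Pairs of complex parameters with equivalent normal forms under complex transformations. -/
def P1 (T₁ T₂ : Subtypes) : Set (ℂ × ℂ) :=
  {p | Admissible T₁ p.1 ∧ Admissible T₂ p.2 ∧ (transporter ℂ (NF T₁ p.1) (NF T₂ p.2)).Nonempty}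

/-- Pairs of real parameters with equivalent normal forms under complex transformations,
as a subset of `ℝ² ⊆ ℂ²`. -/
def P2 (T₁ T₂ : Subtypes) : Set (ℂ × ℂ) :=
  {p | ∃ u v : ℝ, p = ((u : ℂ), (v : ℂ)) ∧ Admissible T₁ u ∧ Admissible T₂ v ∧
    (transporter ℂ (NF T₁ (u : ℂ)) (NF T₂ (v : ℂ))).Nonempty}

/-- Pairs of real parameters with equivalent normal forms under real transformations,
as a subset of `ℝ² ⊆ ℂ²`. -/
def P3 (T₁ T₂ : Subtypes) : Set (ℂ × ℂ) :=
  {p | ∃ u v : ℝ, p = ((u : ℂ), (v : ℂ)) ∧ Admissible T₁ u ∧ Admissible T₂ v ∧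
    (transporter ℝ (NF T₁ u) (NF T₂ v)).Nonempty}

/-- The joint graph `Γ_Ω((fᵢ)ᵢ)` of a family of functions over `Ω ⊆ ℂ`. -/
def jointGraph {ι : Type*} (Ω : Set ℂ) (f : ι → ℂ → ℂ) : Set (ℂ × ℂ) :=
  {p | p.1 ∈ Ω ∧ ∃ i, p.2 = f i p.1}

/-- A set of real numbers regarded as a subset of `ℂ`. -/
def realSet (S : Set ℝ) : Set ℂ := Complex.ofReal '' S

/-- The principal complex square root; on `[0, ∞)` it is the usual real square root. -/
noncomputable def csqrt (z : ℂ) : ℂ := z ^ (1 / 2 : ℂ)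

/-- `f₁^{ρ,σ}`. -/
noncomputable def f1 (ρ σ : ℂ) (a : ℂ) : ℂ := csqrt (ρ * σ) * a

/-- `f₂^{ρ,σ}`. -/
noncomputable def f2 (ρ σ : ℂ) (a : ℂ) : ℂ := -csqrt (ρ * σ) * a

/-- `f₃^{ρ,σ}`. -/
noncomputable def f3 (ρ σ : ℂ) (a : ℂ) : ℂ :=
  csqrt ((-(ρ * σ) * (a ^ 2 - ρ * 4) * (a ^ 2 - ρ * 9)
    + a * (a ^ 2 - ρ * 3) * csqrt (a ^ 2 - ρ * 4)) / (2 * (a ^ 2 - ρ * 4)))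

/-- `f₄^{ρ,σ}`. -/
noncomputable def f4 (ρ σ : ℂ) (a : ℂ) : ℂ :=
  -csqrt ((-(ρ * σ) * (a ^ 2 - ρ * 4) * (a ^ 2 - ρ * 9)
    + a * (a ^ 2 - ρ * 3) * csqrt (a ^ 2 - ρ * 4)) / (2 * (a ^ 2 - ρ * 4)))

/-- `f₅^{ρ,σ}`. -/
noncomputable def f5 (ρ σ : ℂ) (a : ℂ) : ℂ :=
  csqrt ((-(ρ * σ) * (a ^ 2 - ρ * 4) * (a ^ 2 - ρ * 9)
    - a * (a ^ 2 - ρ * 3) * csqrt (a ^ 2 - ρ * 4)) / (2 * (a ^ 2 - ρ * 4)))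

/-- `f₆^{ρ,σ}`. -/
noncomputable def f6 (ρ σ : ℂ) (a : ℂ) : ℂ :=
  -csqrt ((-(ρ * σ) * (a ^ 2 - ρ * 4) * (a ^ 2 - ρ * 9)
    - a * (a ^ 2 - ρ * 3) * csqrt (a ^ 2 - ρ * 4)) / (2 * (a ^ 2 - ρ * 4)))

/-- `ξ = 3 / √2`. -/
noncomputable def xi : ℝ := 3 / Real.sqrt 2

/-- `I₁ = ]ξ, ∞[`. -/
def I1 : Set ℝ := Set.Ioi xi

/-- `I₂ = ]2, ξ[`. -/
def I2 : Set ℝ := Set.Ioo 2 xi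

/-- `I₃ = ]-ξ, -2[`. -/
def I3 : Set ℝ := Set.Ioo (-xi) (-2)

/-- `I₄ = ]-∞, -ξ[`. -/
def I4 : Set ℝ := Set.Iio (-xi)

/-- `ℂ' = ℂ \ {-2, 2}`. -/
def Cprime : Set ℂ := Set.univ \ {-2, 2}

/-- `ℝ' = ℝ \ {-2, 2}`. -/
def Rprime : Set ℝ := Set.univ \ {-2, 2}

/-- `ℂ'' = ℂ \ {-2i, 2i}`. -/
def Cpprime : Set ℂ := Set.univ \ {-2 * Complex.I, 2 * Complex.I}

end J10

open J10

namespace J10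

/-! Both normal forms are quasi-homogeneous of weight 6 for the weights 2 of `x` and 1 of `y`. If an
automorphism carries one to the other, its leading weighted part `x ↦ α x + c y²`, `y ↦ δ y` already
does. Equivalence thus becomes the four equations of `IsTransform` (`transporter_nonempty_iff`): an
affine change of variable between the cubics `X³ + a X² + ρ X` and `X³ + b X² + σ X`.

The coefficient of `y⁶` says that `c = r δ²` for a root `r` of the first cubic. The root `r = 0`
leaves a pure scaling and yields `f₁`, `f₂`. Otherwise `r² + a r + ρ = 0`; with `q = 2 r + a` one
has `q² = a² - 4 ρ`, and the remaining equations are `α δ⁴ q (q - a) = 2 σ` and `2 b = α² δ² (3 q -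
a)` (`exists_isTransform_iff`). Since `α³ = 1`, eliminating `α` and `δ` gives `b² = σ (3 q - a)² /
(2 q (q - a))`, which `branch_eq` identifies with the radicands of `f₃`, ..., `f₆`.

Over `ℂ` every such `b` occurs. Over `ℝ` one has `α = 1` and `δ² > 0`, which adds two conditions: `σ
q (q - a) > 0`, and `b` has the sign of `3 q - a` (`exists_isTransform_real_iff`). For real
parameters and complex maps, an imaginary `q` contributes only where its coefficient in `branch`
vanishes (`exists_isTransform_ofReal_iff`). The rest is the study of these signs; they change at `9
(a² - 4) = a²`, that is, at `a = ±ξ`. -/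

/-- The sign of the `x y⁴` term in the normal form of a subtype. -/
def sgn (K : Type*) [Field K] : Subtypes → K
  | .plus => 1
  | .minus => -1

theorem sgn_sq (K : Type*) [Field K] (T : Subtypes) : sgn K T ^ 2 = 1 := by
  cases T <;> simp [sgn]

theorem NF_eq {K : Type*} [Field K] (T : Subtypes) (a : K) :
    NF T a = (MvPowerSeries.X 0 : PS K) ^ 3
      + algebraMap K (PS K) a * ((MvPowerSeries.X 0) ^ 2 * (MvPowerSeries.X 1) ^ 2)
      + algebraMap K (PS K) (sgn K T) * ((MvPowerSeries.X 0) * (MvPowerSeries.X 1) ^ 4) := by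
  cases T <;> simp [NF, sgn, Algebra.smul_def, sub_eq_add_neg]

/-- The weighted substitution `x ↦ α x + c y²`, `y ↦ δ y` turns `x³ + a x² y² + s x y⁴` into
`x³ + b x² y² + t x y⁴`. -/
structure IsTransform {K : Type*} [Field K] (s t a b α c δ : K) : Prop where
  coeff_x3 : α ^ 3 = 1
  coeff_x2y2 : 3 * α ^ 2 * c + a * α ^ 2 * δ ^ 2 = b
  coeff_xy4 : 3 * α * c ^ 2 + 2 * a * α * c * δ ^ 2 + s * α * δ ^ 4 = t
  coeff_y6 : c ^ 3 + a * c ^ 2 * δ ^ 2 + s * c * δ ^ 4 = 0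

/-! ### Reduction of automorphisms to weighted shears -/

section PowerSeries

open MvPowerSeries

variable {K : Type*} [Field K]

theorem exists_eq_C_add_X_mul (u : PS K) :
    ∃ p q : PS K, u = algebraMap K (PS K) (constantCoeff u) + X 0 * p + X 1 * q := by
  classical
  let w : PS K := u - algebraMap K (PS K) (constantCoeff u)
  -- `w1` collects the terms free of `x`; having no constant term, it is divisible by `y`.
  let w1 : PS K := fun m => if m 0 = 0 then coeff m w else 0
  have hw1 : ∀ m, coeff m w1 = if m 0 = 0 then coeff m w else 0 := fun _ => rfl
  have h0 : constantCoeff w = 0 := by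
    simp [w, MvPowerSeries.algebraMap_apply]
  obtain ⟨q, hq⟩ : (X 1 : PS K) ∣ w1 := by
    rw [X_dvd_iff]
    intro m hm
    rw [hw1]
    split_ifs with h
    · have : m = 0 := by ext i; fin_cases i <;> simp [h, hm]
      rw [this, coeff_zero_eq_constantCoeff_apply, h0]
    · rfl
  obtain ⟨p, hp⟩ : (X 0 : PS K) ∣ w - w1 := by
    rw [X_dvd_iff]
    intro m hm
    rw [map_sub, hw1, if_pos hm, sub_self]
  refine ⟨p, q, ?_⟩
  rw [← hp, ← hq]
  simp only [w]
  ring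

/-- The images of `x` and `y` under the blow-up `x ↦ X t²`, `y ↦ t`. -/
noncomputable def blowup (K : Type*) [Field K] : Fin 2 → MvPowerSeries Unit (Polynomial K) :=
  ![C Polynomial.X * X () ^ 2, X ()]

theorem hasSubst_blowup : HasSubst (blowup K) :=
  hasSubst_of_constantCoeff_zero fun s => by fin_cases s <;> simp [blowup]

/-- The weighted blow-up homomorphism `K[[x, y]] → K[X][[t]]`, `x ↦ X t²`, `y ↦ t`. -/
noncomputable def blowupHom (K : Type*) [Field K] :
    PS K →ₐ[K] MvPowerSeries Unit (Polynomial K) :=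
  substAlgHom hasSubst_blowup

theorem blowupHom_X_zero :
    blowupHom K (X 0) = C Polynomial.X * X () ^ 2 := by
  rw [blowupHom, substAlgHom_X]; rfl

theorem blowupHom_X_one : blowupHom K (X 1) = X () := by
  rw [blowupHom, substAlgHom_X]; rfl

theorem blowupHom_algebraMap (a : K) :
    blowupHom K (algebraMap K (PS K) a) = C (Polynomial.C a) := by
  rw [AlgHom.commutes, MvPowerSeries.algebraMap_apply, Polynomial.algebraMap_eq]

/-- Both variables map to multiples of `t`, so setting `t = 0` leaves only the constant term. This
is how unknown cofactor series become scalars below. -/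
theorem constantCoeff_blowupHom (u : PS K) :
    constantCoeff (blowupHom K u) = Polynomial.C (constantCoeff u) := by
  obtain ⟨p, q, h⟩ := exists_eq_C_add_X_mul u
  conv_lhs => rw [h]
  simp only [map_add, map_mul, map_pow, blowupHom_X_zero, blowupHom_X_one, blowupHom_algebraMap,
    constantCoeff_C, constantCoeff_X]
  simp

/-- Otherwise the image would be a unit, and the inverse automorphism would make the variable itself
a unit. -/
theorem constantCoeff_algEquiv_X (φ : PS K ≃ₐ[K] PS K) (i : Fin 2) :
    constantCoeff (φ (X i)) = 0 := by
  by_contra h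
  have h1 : IsUnit (φ (X i)) := isUnit_iff_constantCoeff.2 (isUnit_iff_ne_zero.2 h)
  have h2 : IsUnit (X i : PS K) := by simpa using h1.map φ.symm
  simpa using isUnit_iff_constantCoeff.1 h2

/-- After the blow-up, the order in `t` measures weight. Cancelling `t⁶` and setting `t = 0`
isolates the leading weighted part of the automorphism: `α` and `c` are the coefficients of `x` and
`y²` in `φ(x)`, and `δ` is that of `y` in `φ(y)`. -/
theorem exists_isTransform_of_apply_eq (T₁ T₂ : Subtypes) (a b : K) (φ : PS K ≃ₐ[K] PS K)
    (h : φ (NF T₁ a) = NF T₂ b) :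
    ∃ α c δ : K, IsTransform (sgn K T₁) (sgn K T₂) a b α c δ := by
  obtain ⟨p, q, hu⟩ := exists_eq_C_add_X_mul (φ (X 0))
  obtain ⟨m, n, hv⟩ := exists_eq_C_add_X_mul (φ (X 1))
  obtain ⟨q1, q2, hq⟩ := exists_eq_C_add_X_mul q
  rw [constantCoeff_algEquiv_X, map_zero, zero_add] at hu hv
  rw [NF_eq, NF_eq] at h
  simp only [map_add, map_mul, map_pow, AlgEquiv.commutes] at h
  set s := sgn K T₁
  set t := sgn K T₂
  have hT : (X () : MvPowerSeries Unit (Polynomial K)) ≠ 0 := fun h0 => by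
    simpa [coeff_X] using congrArg (coeff (Finsupp.single () 1)) h0
  have hT0 : constantCoeff (X () : MvPowerSeries Unit (Polynomial K)) = 0 := constantCoeff_X ()
  have h1 := congrArg (blowupHom K) h
  have hU := congrArg (blowupHom K) hu
  have hV := congrArg (blowupHom K) hv
  have hQ := congrArg (blowupHom K) hq
  simp only [map_add, map_mul, map_pow, blowupHom_algebraMap, blowupHom_X_zero,
    blowupHom_X_one] at h1 hU hV hQ
  have cP := constantCoeff_blowupHom p
  have cQ := constantCoeff_blowupHom q
  have cQ1 := constantCoeff_blowupHom q1
  have cQ2 := constantCoeff_blowupHom q2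
  have cM := constantCoeff_blowupHom m
  have cN := constantCoeff_blowupHom n
  generalize blowupHom K (φ (X 0)) = U at *
  generalize blowupHom K (φ (X 1)) = V at *
  generalize blowupHom K p = P at *
  generalize blowupHom K q = Q at *
  generalize blowupHom K q1 = Q1 at *
  generalize blowupHom K q2 = Q2 at *
  generalize blowupHom K m = M at *
  generalize blowupHom K n = N at *
  generalize (X () : MvPowerSeries Unit (Polynomial K)) = t' at *
  set cX : MvPowerSeries Unit (Polynomial K) := C Polynomial.X with hcX
  have h2 : (cX * t' * P + Q) ^ 3 + C (Polynomial.C a) * t' * (cX * t' * P + Q) ^ 2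
        * (cX * t' * M + N) ^ 2 + C (Polynomial.C s) * t' ^ 2 * (cX * t' * P + Q)
        * (cX * t' * M + N) ^ 4
      = t' ^ 3 * (cX ^ 3 + C (Polynomial.C b) * cX ^ 2 + C (Polynomial.C t) * cX) := by
    apply mul_left_cancel₀ (pow_ne_zero 3 hT)
    rw [hU, hV] at h1
    linear_combination h1
  -- At `t = 0` only the cube of `Q` survives, so `φ(x)` has no linear term in `y`: the automorphism
  -- cannot lower weights.
  have hq0 : constantCoeff q = 0 := by
    have := congrArg constantCoeff h2
    simpa [hT0, cQ] using this
  rw [hq0, map_zero, map_zero, zero_add] at hQ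
  -- Now `Q` is itself divisible by `t`, which allows a second factor `t³` to be cancelled.
  have h3 : (cX * P + cX * t' * Q1 + Q2) ^ 3
        + C (Polynomial.C a) * (cX * P + cX * t' * Q1 + Q2) ^ 2 * (cX * t' * M + N) ^ 2
        + C (Polynomial.C s) * (cX * P + cX * t' * Q1 + Q2) * (cX * t' * M + N) ^ 4
      = cX ^ 3 + C (Polynomial.C b) * cX ^ 2 + C (Polynomial.C t) * cX := by
    apply mul_left_cancel₀ (pow_ne_zero 3 hT)
    rw [hQ] at h2
    linear_combination h2
  have h4 := congrArg constantCoeff h3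
  simp only [map_add, map_mul, map_pow, hT0, cP, cQ1, cQ2, cM, cN, hcX, constantCoeff_C,
    mul_zero, zero_mul, add_zero, zero_add] at h4
  generalize constantCoeff p = α at h4
  generalize constantCoeff q2 = c at h4
  generalize constantCoeff n = δ at h4
  have h5 : Polynomial.C (α ^ 3) * Polynomial.X ^ 3
      + Polynomial.C (3 * α ^ 2 * c + a * α ^ 2 * δ ^ 2) * Polynomial.X ^ 2
      + Polynomial.C (3 * α * c ^ 2 + 2 * a * α * c * δ ^ 2 + s * α * δ ^ 4) * Polynomial.X
      + Polynomial.C (c ^ 3 + a * c ^ 2 * δ ^ 2 + s * c * δ ^ 4)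
      = Polynomial.C 1 * Polynomial.X ^ 3 + Polynomial.C b * Polynomial.X ^ 2
        + Polynomial.C t * Polynomial.X + Polynomial.C 0 := by
    have e2 : Polynomial.C (2 : K) = 2 := rfl
    have e3 : Polynomial.C (3 : K) = 3 := rfl
    simp only [map_add, map_mul, map_pow, map_one, map_zero, e2, e3]
    linear_combination h4
  obtain ⟨e1, e2, e3, e4⟩ := Cubic.mk.inj ((Cubic.toPoly_injective _ _).1
    (show (⟨_, _, _, _⟩ : Cubic K).toPoly = (⟨_, _, _, _⟩ : Cubic K).toPoly from h5))
  exact ⟨α, c, δ, e1, e2, e3, e4⟩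

/-- The images of `x` and `y` under the substitution `x ↦ α x + c y²`, `y ↦ δ y`. -/
noncomputable def shear (α c δ : K) : Fin 2 → PS K :=
  ![algebraMap K (PS K) α * X 0 + algebraMap K (PS K) c * X 1 ^ 2, algebraMap K (PS K) δ * X 1]

theorem hasSubst_shear (α c δ : K) : HasSubst (shear α c δ) :=
  hasSubst_of_constantCoeff_zero fun s => by fin_cases s <;> simp [shear]

/-- The endomorphism `x ↦ α x + c y²`, `y ↦ δ y` of `K[[x, y]]`. -/
noncomputable def shearHom (α c δ : K) : PS K →ₐ[K] PS K := substAlgHom (hasSubst_shear α c δ)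

theorem shearHom_X_zero (α c δ : K) : shearHom α c δ (X 0) =
    algebraMap K (PS K) α * X 0 + algebraMap K (PS K) c * X 1 ^ 2 := by
  rw [shearHom, substAlgHom_X]; rfl

theorem shearHom_X_one (α c δ : K) : shearHom α c δ (X 1) = algebraMap K (PS K) δ * X 1 := by
  rw [shearHom, substAlgHom_X]; rfl

/-- A composite of substitutions is a substitution, so it suffices to check the images of the two
variables; the hypotheses are the coefficients found there. -/
theorem shearHom_comp_shearHom {α c δ α' c' δ' : K} (hα : α * α' = 1) (hδ : δ * δ' = 1)
    (hc : α * c' + c * δ' ^ 2 = 0) :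
    (shearHom α' c' δ').comp (shearHom α c δ) = AlgHom.id K (PS K) := by
  have key : (fun i => subst (shear α' c' δ') (shear α c δ i)) = (X : Fin 2 → PS K) := by
    funext i
    rw [← substAlgHom_apply (hasSubst_shear α' c' δ')]
    change shearHom α' c' δ' (shear α c δ i) = X i
    have h1 := congrArg (algebraMap K (PS K)) hα
    have h2 := congrArg (algebraMap K (PS K)) hδ
    have h3 := congrArg (algebraMap K (PS K)) hc
    simp only [map_add, map_mul, map_pow, map_one, map_zero] at h1 h2 h3
    fin_cases i
    · change shearHom α' c' δ'
        (algebraMap K (PS K) α * X 0 + algebraMap K (PS K) c * X 1 ^ 2) = X 0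
      simp only [map_add, map_mul, map_pow, shearHom_X_zero, shearHom_X_one, AlgHom.commutes]
      linear_combination X 0 * h1 + X 1 ^ 2 * h3
    · change shearHom α' c' δ' (algebraMap K (PS K) δ * X 1) = X 1
      simp only [map_mul, shearHom_X_one, AlgHom.commutes]
      linear_combination X 1 * h2
  ext1 f
  simp only [shearHom, AlgHom.comp_apply, substAlgHom_apply]
  rw [subst_comp_subst_apply (hasSubst_shear _ _ _) (hasSubst_shear _ _ _), key, subst_self]
  rfl

/-- The automorphism `x ↦ α x + c y²`, `y ↦ δ y` of `K[[x, y]]`. -/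
noncomputable def shearEquiv (α c δ : K) (hα : α ≠ 0) (hδ : δ ≠ 0) : PS K ≃ₐ[K] PS K :=
  AlgEquiv.ofAlgHom (shearHom α c δ) (shearHom α⁻¹ (-(α⁻¹ * c * (δ⁻¹) ^ 2)) δ⁻¹)
    (shearHom_comp_shearHom (by field_simp) (by field_simp) (by field_simp; ring))
    (shearHom_comp_shearHom (by field_simp) (by field_simp) (by field_simp; ring))

theorem IsTransform.transporter_nonempty {T₁ T₂ : Subtypes} {a b α c δ : K}
    (h : IsTransform (sgn K T₁) (sgn K T₂) a b α c δ) :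
    (transporter K (NF T₁ a) (NF T₂ b)).Nonempty := by
  have hα : α ≠ 0 := fun h0 => by simpa [h0] using h.coeff_x3
  -- If `δ = 0`, then the `y⁶` equation gives `c = 0`, and the `x y⁴` equation would make a sign
  -- zero.
  have hδ : δ ≠ 0 := fun h0 => by
    have h1 : c = 0 := by simpa [h0] using h.coeff_y6
    have h2 := h.coeff_xy4
    have h3 := sgn_sq K T₂
    simp [h0, h1] at h2
    simp [← h2] at h3
  refine ⟨shearEquiv α c δ hα hδ, ?_⟩
  change shearHom α c δ (NF T₁ a) = NF T₂ b
  simp only [NF_eq, map_add, map_mul, map_pow, shearHom_X_zero, shearHom_X_one, AlgHom.commutes]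
  have h1 := congrArg (algebraMap K (PS K)) h.coeff_x3
  have h2 := congrArg (algebraMap K (PS K)) h.coeff_x2y2
  have h3 := congrArg (algebraMap K (PS K)) h.coeff_xy4
  have h4 := congrArg (algebraMap K (PS K)) h.coeff_y6
  simp only [map_add, map_mul, map_pow, map_one, map_zero, map_ofNat] at h1 h2 h3 h4
  linear_combination X 0 ^ 3 * h1 + X 0 ^ 2 * X 1 ^ 2 * h2 + X 0 * X 1 ^ 4 * h3 + X 1 ^ 6 * h4

theorem transporter_nonempty_iff (T₁ T₂ : Subtypes) (a b : K) :
    (transporter K (NF T₁ a) (NF T₂ b)).Nonempty ↔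
      ∃ α c δ : K, IsTransform (sgn K T₁) (sgn K T₂) a b α c δ :=
  ⟨fun ⟨φ, h⟩ => exists_isTransform_of_apply_eq T₁ T₂ a b φ h,
    fun ⟨_, _, _, h⟩ => h.transporter_nonempty⟩

end PowerSeries

/-! ### Discriminants and elimination of the shear coefficient -/

section Field

variable {K : Type*} [Field K]

/-- The value of `b²` on the branch of the equivalence relation that belongs to a square root `q`
of `a² - 4ρ`. -/
def branch (ρ σ a q : K) : K :=
  (-(ρ * σ) * (a ^ 2 - ρ * 4) * (a ^ 2 - ρ * 9) + a * (a ^ 2 - ρ * 3) * q) / (2 * (a ^ 2 - ρ * 4))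

theorem IsTransform.ne_zero {ρ σ a b α c δ : K} (hσ : σ ^ 2 = 1)
    (h : IsTransform ρ σ a b α c δ) : δ ≠ 0 := fun h0 => by
  have h1 : c = 0 := by simpa [h0] using h.coeff_y6
  have h2 := h.coeff_xy4
  simp [h0, h1] at h2
  simp [← h2] at hσ

/-- The discriminants of equivalent normal forms differ by a unit factor. -/
theorem IsTransform.discrim {ρ σ a b α c δ : K} (hρ : ρ ^ 2 = 1) (hσ : σ ^ 2 = 1)
    (h : IsTransform ρ σ a b α c δ) : b ^ 2 - 4 * σ = δ ^ 12 * (a ^ 2 - 4 * ρ) := by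
  obtain ⟨h1, h2, h3, h4⟩ := h
  -- Discriminant of a cubic under an affine substitution: the left side is that of the transformed
  -- cubic, and `ρ² (a² - 4 ρ)` is that of `X³ + a X² + ρ X`.
  have e : (3 * α ^ 2 * c + a * α ^ 2 * δ ^ 2) ^ 2
        * (3 * α * c ^ 2 + 2 * a * α * c * δ ^ 2 + ρ * α * δ ^ 4) ^ 2
      - 4 * α ^ 3 * (3 * α * c ^ 2 + 2 * a * α * c * δ ^ 2 + ρ * α * δ ^ 4) ^ 3
      - 4 * (3 * α ^ 2 * c + a * α ^ 2 * δ ^ 2) ^ 3 * (c ^ 3 + a * c ^ 2 * δ ^ 2 + ρ * c * δ ^ 4)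
      - 27 * (α ^ 3) ^ 2 * (c ^ 3 + a * c ^ 2 * δ ^ 2 + ρ * c * δ ^ 4) ^ 2
      + 18 * α ^ 3 * (3 * α ^ 2 * c + a * α ^ 2 * δ ^ 2)
        * (3 * α * c ^ 2 + 2 * a * α * c * δ ^ 2 + ρ * α * δ ^ 4)
        * (c ^ 3 + a * c ^ 2 * δ ^ 2 + ρ * c * δ ^ 4)
      = (α ^ 3) ^ 2 * δ ^ 12 * (ρ ^ 2 * (a ^ 2 - 4 * ρ)) := by ring
  rw [h1, h2, h3, h4, hρ] at e
  linear_combination e - (b ^ 2 - 4 * σ) * hσ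

/-- Because of this, one condition on `a` can replace the restrictions on both parameters. -/
theorem IsTransform.discrim_ne_zero_iff {ρ σ a b α c δ : K} (hρ : ρ ^ 2 = 1) (hσ : σ ^ 2 = 1)
    (h : IsTransform ρ σ a b α c δ) : b ^ 2 ≠ 4 * σ ↔ a ^ 2 ≠ 4 * ρ := by
  rw [← sub_ne_zero, h.discrim hρ hσ, mul_ne_zero_iff, sub_ne_zero]
  exact and_iff_right (pow_ne_zero _ (h.ne_zero hσ))

/-- The two alternatives are `c = 0` and `c = r δ²` with `r² + a r + ρ = 0`; in the second, `q = 2 r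
+ a`, whence `c = (q - a) / 2 * δ²` in the converse. -/
theorem exists_isTransform_iff [CharZero K] {ρ σ a b : K} (hσ : σ ^ 2 = 1) :
    (∃ α c δ : K, IsTransform ρ σ a b α c δ) ↔
      ∃ α δ : K, α ^ 3 = 1 ∧ ((b = a * α ^ 2 * δ ^ 2 ∧ ρ * α * δ ^ 4 = σ) ∨
        ∃ q, q ^ 2 = a ^ 2 - 4 * ρ ∧ α * δ ^ 4 * (q * (q - a)) = 2 * σ ∧
          2 * b = α ^ 2 * δ ^ 2 * (3 * q - a)) := by
  constructor
  · rintro ⟨α, c, δ, h⟩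
    have hδ := h.ne_zero hσ
    obtain ⟨h1, h2, h3, h4⟩ := h
    refine ⟨α, δ, h1, ?_⟩
    by_cases hc : c = 0
    · left
      subst hc
      exact ⟨by linear_combination -h2, by linear_combination h3⟩
    · right
      obtain ⟨r, rfl⟩ : ∃ r, c = r * δ ^ 2 := ⟨c / δ ^ 2, by field_simp⟩
      have hr : r ^ 2 + a * r + ρ = 0 := by
        have h5 : (r * δ ^ 2 * δ ^ 4) * (r ^ 2 + a * r + ρ) = 0 := by linear_combination h4
        exact (mul_eq_zero.1 h5).resolve_left (mul_ne_zero hc (pow_ne_zero _ hδ))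
      exact ⟨2 * r + a, by linear_combination 4 * hr,
        by linear_combination 2 * h3 - 2 * α * δ ^ 4 * hr, by linear_combination -2 * h2⟩
  · rintro ⟨α, δ, h1, ⟨h2, h3⟩ | ⟨q, hq, h2, h3⟩⟩
    · exact ⟨α, 0, δ, h1, by rw [h2]; ring, by rw [← h3]; ring, by ring⟩
    · refine ⟨α, (q - a) / 2 * δ ^ 2, δ, h1, ?_, ?_, ?_⟩
      · linear_combination -h3 / 2
      · linear_combination h2 / 2 + α * δ ^ 4 / 4 * hq
      · linear_combination (q - a) / 8 * δ ^ 6 * hq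

/-- The factor `-(ρ * σ)` matches the root `q` of the transformation with the square root written in
`f₃`, ..., `f₆`. In this form the numerator is a sign times a square, so the sign of the radicand is
that of `σ q (q - a)` wherever `3 q ≠ a`. -/
theorem branch_eq [CharZero K] {ρ σ a q : K} (hρ : ρ ^ 2 = 1)
    (hq : q ^ 2 = a ^ 2 - 4 * ρ) (hq0 : q ≠ 0) (hqa : q - a ≠ 0) :
    branch ρ σ a (-(ρ * σ) * q) = σ * (3 * q - a) ^ 2 / (2 * (q * (q - a))) := by
  have e : a ^ 2 - ρ * 4 = q ^ 2 := by rw [hq]; ring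
  rw [branch, e]
  have h3 : a ^ 2 - ρ * 9 = (9 * q ^ 2 - 5 * a ^ 2) / 4 := by linear_combination 9 / 4 * e
  have h4 : a ^ 2 - ρ * 3 = (3 * q ^ 2 + a ^ 2) / 4 := by linear_combination 3 / 4 * e
  rw [h3, h4, div_eq_div_iff (by simp [hq0]) (by simp [hq0, hqa])]
  have h5 : ρ * (q ^ 2 - a ^ 2) = -4 := by linear_combination ρ * hq - 4 * hρ
  linear_combination (-σ) * q ^ 2 * (3 * q - a) ^ 2 / 2 * h5

theorem sub_ne_zero_of_sq_eq [CharZero K] {ρ a q : K} (hρ : ρ ^ 2 = 1)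
    (hq : q ^ 2 = a ^ 2 - 4 * ρ) : q - a ≠ 0 := fun h => by
  rw [sub_eq_zero.1 h] at hq
  have : ρ = 0 := by linear_combination hq / 4
  simp [this] at hρ

theorem admissible_iff (T : Subtypes) (a : K) :
    Admissible T a ↔ (T = .plus → a ^ 2 ≠ 4 * sgn K T) := by
  cases T <;> simp [Admissible, sgn]

end Field

/-! ### Complex equivalence and `P1` -/

section Complex

theorem csqrt_sq (z : ℂ) : csqrt z ^ 2 = z := by
  have := Complex.cpow_nat_inv_pow z two_ne_zero
  rwa [csqrt, one_div]

theorem sq_eq_iff_csqrt {w z : ℂ} : w ^ 2 = z ↔ w = csqrt z ∨ w = -csqrt z := by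
  rw [← sq_eq_sq_iff_eq_or_eq_neg, csqrt_sq]

theorem csqrt_ofReal {x : ℝ} (hx : 0 ≤ x) : csqrt (x : ℂ) = (√x : ℝ) := by
  rw [csqrt, Real.sqrt_eq_rpow, Complex.ofReal_cpow hx]; simp

theorem eq_f1_or_f2_iff {ρ σ a b : ℂ} :
    b = f1 ρ σ a ∨ b = f2 ρ σ a ↔ b ^ 2 = ρ * σ * a ^ 2 := by
  rw [f1, f2, neg_mul, ← sq_eq_sq_iff_eq_or_eq_neg, mul_pow, csqrt_sq]

theorem f3_eq (ρ σ a : ℂ) : f3 ρ σ a = csqrt (branch ρ σ a (csqrt (a ^ 2 - ρ * 4))) := rfl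

theorem f4_eq (ρ σ a : ℂ) : f4 ρ σ a = -f3 ρ σ a := rfl

theorem f5_eq (ρ σ a : ℂ) : f5 ρ σ a = csqrt (branch ρ σ a (-csqrt (a ^ 2 - ρ * 4))) := by
  rw [f5, branch, mul_neg, ← sub_eq_add_neg]

theorem f6_eq (ρ σ a : ℂ) : f6 ρ σ a = -f5 ρ σ a := rfl

theorem eq_f3_or_f4_iff {ρ σ a b : ℂ} :
    b = f3 ρ σ a ∨ b = f4 ρ σ a ↔ b ^ 2 = branch ρ σ a (csqrt (a ^ 2 - ρ * 4)) := by
  rw [f4_eq, f3_eq, sq_eq_iff_csqrt]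

theorem eq_f5_or_f6_iff {ρ σ a b : ℂ} :
    b = f5 ρ σ a ∨ b = f6 ρ σ a ↔ b ^ 2 = branch ρ σ a (-csqrt (a ^ 2 - ρ * 4)) := by
  rw [f6_eq, f5_eq, sq_eq_iff_csqrt]

/-- Squaring eliminates `α` and `δ`. Nothing is lost: with `α = 1` and `δ² = d`, the equations
prescribe only `d²`, and the sign of `d` can be chosen to fit `b`. -/
theorem exists_isTransform_complex_iff {ρ σ a b : ℂ} (hρ : ρ ^ 2 = 1) (hσ : σ ^ 2 = 1) :
    (∃ α c δ : ℂ, IsTransform ρ σ a b α c δ) ↔ b ^ 2 = ρ * σ * a ^ 2 ∨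
      (a ^ 2 ≠ 4 * ρ ∧ ∃ q, q ^ 2 = a ^ 2 - 4 * ρ ∧ b ^ 2 = branch ρ σ a q) := by
  have hρσ : (ρ * σ) ^ 2 = 1 := by rw [mul_pow, hρ, hσ, one_mul]
  have hσ0 : σ ≠ 0 := fun h => by simp [h] at hσ
  rw [exists_isTransform_iff hσ]
  constructor
  · rintro ⟨α, δ, h1, ⟨h2, h3⟩ | ⟨q, hq, h2, h3⟩⟩
    · left
      rw [h2, ← h3]
      linear_combination a ^ 2 * α * δ ^ 4 * h1 - a ^ 2 * α * δ ^ 4 * hρ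
    · right
      have hq0 : q ≠ 0 := fun h => by simp [h, hσ0] at h2
      have hqa := sub_ne_zero_of_sq_eq hρ hq
      refine ⟨fun h => hq0 (by simpa [h] using hq), -(ρ * σ) * q, ?_, ?_⟩
      · linear_combination hq + q ^ 2 * hρσ
      · rw [branch_eq hρ hq hq0 hqa, eq_div_iff (by simp [hq0, hqa])]
        linear_combination (2 * b + α ^ 2 * δ ^ 2 * (3 * q - a)) * q * (q - a) / 2 * h3
          + α * δ ^ 4 * (3 * q - a) ^ 2 * q * (q - a) / 2 * h1
          + (3 * q - a) ^ 2 / 2 * h2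
  · rintro (h | ⟨h0, q', hq', h⟩)
    · obtain ⟨d, hd, rfl⟩ : ∃ d : ℂ, d ^ 2 = ρ * σ ∧ b = d * a := by
        rcases eq_f1_or_f2_iff.2 h with h | h
        · exact ⟨_, csqrt_sq _, h⟩
        · exact ⟨_, by rw [neg_sq, csqrt_sq], h⟩
      refine ⟨1, csqrt d, by simp, Or.inl ⟨?_, ?_⟩⟩
      · rw [csqrt_sq]; ring
      · linear_combination ρ * (csqrt d ^ 2 + d) * csqrt_sq d + ρ * hd + σ * hρ
    · obtain ⟨q, rfl⟩ : ∃ q, q' = -(ρ * σ) * q := ⟨-(ρ * σ) * q', by linear_combination -q' * hρσ⟩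
      have hq : q ^ 2 = a ^ 2 - 4 * ρ := by linear_combination hq' - q ^ 2 * hρσ
      have hq0 : q ≠ 0 := fun h1 => h0 (by rw [h1] at hq; linear_combination -hq)
      have hqa := sub_ne_zero_of_sq_eq hρ hq
      rw [branch_eq hρ hq hq0 hqa] at h
      have hc := csqrt_sq (2 * σ / (q * (q - a)))
      have h' : b ^ 2 = (csqrt (2 * σ / (q * (q - a))) * (3 * q - a) / 2) ^ 2 := by
        rw [h, div_pow, mul_pow, hc]; field_simp
      obtain ⟨d, hd, hb⟩ : ∃ d : ℂ, d ^ 2 = 2 * σ / (q * (q - a)) ∧ b = d * (3 * q - a) / 2 := by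
        rcases sq_eq_sq_iff_eq_or_eq_neg.1 h' with h | h
        · exact ⟨_, hc, h⟩
        · exact ⟨-csqrt (2 * σ / (q * (q - a))), by rw [neg_sq, hc], by rw [h]; ring⟩
      refine ⟨1, csqrt d, by simp, Or.inr ⟨q, hq, ?_, ?_⟩⟩
      · rw [show csqrt d ^ 4 = (csqrt d ^ 2) ^ 2 by ring, csqrt_sq, hd]
        field_simp
      · rw [csqrt_sq, hb]; ring

theorem exists_sq_eq_and_branch_iff {ρ σ a b : ℂ} :
    (∃ q, q ^ 2 = a ^ 2 - 4 * ρ ∧ b ^ 2 = branch ρ σ a q) ↔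
      b ^ 2 = branch ρ σ a (csqrt (a ^ 2 - ρ * 4)) ∨
        b ^ 2 = branch ρ σ a (-csqrt (a ^ 2 - ρ * 4)) := by
  rw [mul_comm ρ]
  simp only [sq_eq_iff_csqrt (z := a ^ 2 - 4 * ρ), or_and_right, exists_or, exists_eq_left]

theorem mem_P1_iff (T₁ T₂ : Subtypes) (p : ℂ × ℂ) : p ∈ P1 T₁ T₂ ↔
    Admissible T₁ p.1 ∧ Admissible T₂ p.2 ∧
      ∃ α c δ, IsTransform (sgn ℂ T₁) (sgn ℂ T₂) p.1 p.2 α c δ := by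
  rw [← transporter_nonempty_iff]; rfl

/-- The discriminant relation moves the restriction on the second parameter to the first. When both
subtypes are minus no restriction remains, but the last four functions still need `q ≠ 0`. -/
theorem mem_P1_iff_eq (T₁ T₂ : Subtypes) (p : ℂ × ℂ) : p ∈ P1 T₁ T₂ ↔
    (T₁ = .plus ∨ T₂ = .plus → p.1 ^ 2 ≠ 4 * sgn ℂ T₁) ∧
      ((p.2 = f1 (sgn ℂ T₁) (sgn ℂ T₂) p.1 ∨ p.2 = f2 (sgn ℂ T₁) (sgn ℂ T₂) p.1) ∨
      p.1 ^ 2 ≠ 4 * sgn ℂ T₁ ∧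
      ((p.2 = f3 (sgn ℂ T₁) (sgn ℂ T₂) p.1 ∨ p.2 = f4 (sgn ℂ T₁) (sgn ℂ T₂) p.1) ∨
      (p.2 = f5 (sgn ℂ T₁) (sgn ℂ T₂) p.1 ∨ p.2 = f6 (sgn ℂ T₁) (sgn ℂ T₂) p.1))) := by
  rw [eq_f1_or_f2_iff, eq_f3_or_f4_iff, eq_f5_or_f6_iff, ← exists_sq_eq_and_branch_iff,
    ← exists_isTransform_complex_iff (sgn_sq _ _) (sgn_sq _ _), mem_P1_iff, admissible_iff,
    admissible_iff, ← and_assoc]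
  refine and_congr_left fun ⟨α, c, δ, h⟩ => ?_
  rw [h.discrim_ne_zero_iff (sgn_sq _ _) (sgn_sq _ _), or_imp]

theorem mem_Cprime_iff {a : ℂ} : a ∈ Cprime ↔ a ^ 2 ≠ 4 := by
  rw [show (4 : ℂ) = 2 ^ 2 by norm_num, Ne, sq_eq_sq_iff_eq_or_eq_neg]
  simp [Cprime, and_comm]

theorem mem_Cpprime_iff {a : ℂ} : a ∈ Cpprime ↔ a ^ 2 ≠ -4 := by
  rw [show (-4 : ℂ) = (2 * Complex.I) ^ 2 by rw [mul_pow, Complex.I_sq]; norm_num, Ne,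
    sq_eq_sq_iff_eq_or_eq_neg]
  simp [Cpprime, and_comm]

theorem P1_plus_plus : P1 .plus .plus =
    jointGraph Cprime ![f1 1 1, f2 1 1, f3 1 1, f4 1 1, f5 1 1, f6 1 1] := by
  ext p
  simp only [mem_P1_iff_eq, jointGraph, Set.mem_ofPred_eq, mem_Cprime_iff, sgn,
    Fin.exists_fin_succ]
  simp
  tauto

theorem P1_minus_minus : P1 .minus .minus =
    jointGraph Set.univ ![f1 (-1) (-1), f2 (-1) (-1)]
      ∪ jointGraph Cpprime ![f3 (-1) (-1), f4 (-1) (-1), f5 (-1) (-1), f6 (-1) (-1)] := by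
  ext p
  simp only [mem_P1_iff_eq, jointGraph, Set.mem_ofPred_eq, Set.mem_union, mem_Cpprime_iff, sgn,
    Fin.exists_fin_succ]
  simp
  tauto

theorem P1_plus_minus : P1 .plus .minus =
    jointGraph Cprime
      ![f1 1 (-1), f2 1 (-1), f3 1 (-1), f4 1 (-1), f5 1 (-1), f6 1 (-1)] := by
  ext p
  simp only [mem_P1_iff_eq, jointGraph, Set.mem_ofPred_eq, mem_Cprime_iff, sgn,
    Fin.exists_fin_succ]
  simp
  tauto

theorem P1_minus_plus : P1 .minus .plus =
    jointGraph Cpprime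
      ![f1 (-1) 1, f2 (-1) 1, f3 (-1) 1, f4 (-1) 1, f5 (-1) 1, f6 (-1) 1] := by
  ext p
  simp only [mem_P1_iff_eq, jointGraph, Set.mem_ofPred_eq, mem_Cpprime_iff, sgn,
    Fin.exists_fin_succ]
  simp
  tauto

end Complex

/-! ### Real equivalence, and complex equivalence of real parameters -/

theorem exists_isTransform_real_iff {ρ σ a b : ℝ} (hρ : ρ ^ 2 = 1) (hσ : σ ^ 2 = 1) :
    (∃ α c δ : ℝ, IsTransform ρ σ a b α c δ) ↔ (ρ = σ ∧ b = a) ∨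
      ∃ q, q ^ 2 = a ^ 2 - 4 * ρ ∧ 0 < σ * (q * (q - a)) ∧
        ((0 ≤ 3 * q - a ∧ b = √(branch ρ σ a (-(ρ * σ) * q))) ∨
          (3 * q - a ≤ 0 ∧ b = -√(branch ρ σ a (-(ρ * σ) * q)))) := by
  have hσ0 : σ ≠ 0 := fun h => by simp [h] at hσ
  rw [exists_isTransform_iff hσ]
  constructor
  · rintro ⟨α, δ, h1, h⟩
    -- The only real cube root of unity is 1.
    obtain rfl : α = 1 := by
      have h2 : (α - 1) * (α ^ 2 + α + 1) = 0 := by linear_combination h1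
      rcases mul_eq_zero.1 h2 with h2 | h2
      · linarith
      · nlinarith [sq_nonneg (2 * α + 1)]
    obtain ⟨h2, h3⟩ | ⟨q, hq, h2, h3⟩ := h
    · left
      have h5 : δ ^ 2 = 1 := by
        have h6 : (δ ^ 4 - 1) * (δ ^ 4 + 1) = 0 := by
          have := congrArg (· ^ 2) h3
          simp only [mul_one, mul_pow, hρ, hσ] at this
          linear_combination this
        have h7 : δ ^ 4 = 1 := by
          rcases mul_eq_zero.1 h6 with h | h
          · linarith
          · nlinarith [sq_nonneg (δ ^ 2)]
        nlinarith [sq_nonneg δ]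
      exact ⟨by rw [← h3]; linear_combination -ρ * (δ ^ 2 + 1) * h5, by rw [h2, h5]; ring⟩
    · right
      have hq0 : q ≠ 0 := fun h => by simp [h, hσ0] at h2
      have hqa := sub_ne_zero_of_sq_eq hρ hq
      have hδ : δ ≠ 0 := fun h => by simp [h, hσ0] at h2
      have hpos : 0 < σ * (q * (q - a)) := by
        have h4 : 0 < δ ^ 4 * (σ * (q * (q - a))) := by
          have : δ ^ 4 * (σ * (q * (q - a))) = 2 := by linear_combination σ * h2 + 2 * hσ
          linarith
        exact pos_of_mul_pos_right h4 (by positivity)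
      have hb : branch ρ σ a (-(ρ * σ) * q) = (δ ^ 2 * (3 * q - a) / 2) ^ 2 := by
        rw [branch_eq hρ hq hq0 hqa, div_eq_iff (by simp [hq0, hqa])]
        linear_combination -(3 * q - a) ^ 2 / 2 * h2
      refine ⟨q, hq, hpos, ?_⟩
      rw [hb, Real.sqrt_sq_eq_abs]
      rcases le_total 0 (3 * q - a) with h | h
      · exact Or.inl ⟨h, by rw [abs_of_nonneg (by positivity)]; linarith⟩
      · refine Or.inr ⟨h, ?_⟩
        rw [abs_of_nonpos (by nlinarith [sq_nonneg δ])]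
        linarith
  · rintro (⟨rfl, rfl⟩ | ⟨q, hq, hpos, h⟩)
    · exact ⟨1, 1, by simp, Or.inl ⟨by simp, by simp⟩⟩
    · have hqq : q * (q - a) ≠ 0 := fun h => by simp [h] at hpos
      have hq0 := left_ne_zero_of_mul hqq
      have hqa := right_ne_zero_of_mul hqq
      have hk : 0 < 2 * σ / (q * (q - a)) := by
        have : 2 * σ / (q * (q - a)) = 2 / (σ * (q * (q - a))) := by
          rw [div_eq_div_iff hqq hpos.ne']; linear_combination 2 * (q * (q - a)) * hσ
        rw [this]; positivity
      -- `d` is the value of `δ²`; being nonnegative, it cannot absorb the sign of `b`.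
      set d := √(2 * σ / (q * (q - a))) with hd
      have hd0 : 0 ≤ d := Real.sqrt_nonneg _
      have hd2 : d ^ 2 = 2 * σ / (q * (q - a)) := Real.sq_sqrt hk.le
      have hb : branch ρ σ a (-(ρ * σ) * q) = (d * (3 * q - a) / 2) ^ 2 := by
        rw [branch_eq hρ hq hq0 hqa, div_pow, mul_pow, hd2]
        field_simp
      rw [hb, Real.sqrt_sq_eq_abs] at h
      refine ⟨1, √d, by simp, Or.inr ⟨q, hq, ?_, ?_⟩⟩
      · rw [show √d ^ 4 = (√d ^ 2) ^ 2 by ring, Real.sq_sqrt hd0, hd2]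
        field_simp
      · rw [Real.sq_sqrt hd0]
        rcases h with ⟨h, h'⟩ | ⟨h, h'⟩
        · rw [h', abs_of_nonneg (by positivity)]; ring
        · rw [h', abs_of_nonpos (by nlinarith)]; ring

theorem branch_ofReal (ρ σ a q : ℝ) :
    branch (ρ : ℂ) σ a q = ((branch ρ σ a q : ℝ) : ℂ) := by
  simp [branch]

theorem exists_isTransform_ofReal_iff {ρ σ a b : ℝ} (hρ : ρ ^ 2 = 1) (hσ : σ ^ 2 = 1) :
    (∃ α c δ : ℂ, IsTransform (ρ : ℂ) σ a b α c δ) ↔ b ^ 2 = ρ * σ * a ^ 2 ∨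
      (4 * ρ < a ^ 2 ∧ (b ^ 2 = branch ρ σ a √(a ^ 2 - 4 * ρ) ∨
        b ^ 2 = branch ρ σ a (-√(a ^ 2 - 4 * ρ)))) ∨
      (a ^ 2 < 4 * ρ ∧ a * (a ^ 2 - 3 * ρ) = 0 ∧ 2 * b ^ 2 = -(ρ * σ) * (a ^ 2 - 9 * ρ)) := by
  rw [exists_isTransform_complex_iff (mod_cast hρ) (mod_cast hσ)]
  refine or_congr (by norm_cast) ?_
  constructor
  · rintro ⟨h0, q, hq, h⟩
    have h0' : a ^ 2 ≠ 4 * ρ := mod_cast h0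
    rcases lt_or_gt_of_ne h0' with hlt | hlt
    · right
      have hne : a ^ 2 - ρ * 4 ≠ 0 := by linarith
      have hneC : (a : ℂ) ^ 2 - ρ * 4 ≠ 0 := mod_cast hne
      have hm : a * (a ^ 2 - ρ * 3) * q =
          ((2 * (a ^ 2 - ρ * 4) * b ^ 2 + ρ * σ * (a ^ 2 - ρ * 4) * (a ^ 2 - ρ * 9) : ℝ) : ℂ) := by
        rw [branch, eq_div_iff (by simpa using hneC)] at h
        push_cast
        linear_combination -h
      set X := 2 * (a ^ 2 - ρ * 4) * b ^ 2 + ρ * σ * (a ^ 2 - ρ * 4) * (a ^ 2 - ρ * 9) with hX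
      -- Squaring removes the imaginary `q`: a nonpositive real number equals a real square, so both
      -- vanish.
      have hm2 : (a * (a ^ 2 - ρ * 3)) ^ 2 * (a ^ 2 - 4 * ρ) = X ^ 2 := by
        have := congrArg (· ^ 2) hm
        simp only [mul_pow, hq] at this
        have h' : (((a * (a ^ 2 - ρ * 3)) ^ 2 * (a ^ 2 - 4 * ρ) : ℝ) : ℂ) = ((X ^ 2 : ℝ) : ℂ) := by
          push_cast
          linear_combination this
        exact_mod_cast h'
      have hz : a * (a ^ 2 - ρ * 3) = 0 := by
        by_contra hz
        have h1 : 0 < (a * (a ^ 2 - ρ * 3)) ^ 2 := by positivity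
        nlinarith [sq_nonneg X]
      have hX0 : X = 0 := by
        rw [hz] at hm2
        nlinarith
      refine ⟨hlt, by rw [mul_comm 3]; exact hz, ?_⟩
      apply mul_left_cancel₀ hne
      linear_combination hX0
    · left
      have hs : √(a ^ 2 - 4 * ρ) ^ 2 = a ^ 2 - 4 * ρ := Real.sq_sqrt (by linarith)
      have hs' : q ^ 2 = ((√(a ^ 2 - 4 * ρ) : ℝ) : ℂ) ^ 2 := by
        rw [hq]; exact_mod_cast hs.symm
      refine ⟨hlt, ?_⟩
      rcases sq_eq_sq_iff_eq_or_eq_neg.1 hs' with rfl | rfl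
      · left
        rw [branch_ofReal] at h
        exact_mod_cast h
      · right
        rw [← Complex.ofReal_neg, branch_ofReal] at h
        exact_mod_cast h
  · rintro (⟨hlt, h⟩ | ⟨hlt, h1, h2⟩)
    · have hs : √(a ^ 2 - 4 * ρ) ^ 2 = a ^ 2 - 4 * ρ := Real.sq_sqrt (by linarith)
      refine ⟨mod_cast hlt.ne', ?_⟩
      rcases h with h | h
      · exact ⟨(√(a ^ 2 - 4 * ρ) : ℝ), mod_cast hs, by rw [branch_ofReal]; exact_mod_cast h⟩
      · exact ⟨(-√(a ^ 2 - 4 * ρ) : ℝ), by rw [← Complex.ofReal_pow, neg_sq, hs]; push_cast; ring,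
          by rw [branch_ofReal]; exact_mod_cast h⟩
    · have hne : a ^ 2 - ρ * 4 ≠ 0 := by linarith
      have hneC : (a : ℂ) ^ 2 - ρ * 4 ≠ 0 := mod_cast hne
      refine ⟨mod_cast hlt.ne, csqrt (a ^ 2 - 4 * ρ), csqrt_sq _, ?_⟩
      have h1' : (a : ℂ) * (a ^ 2 - 3 * ρ) = 0 := mod_cast h1
      have h2' : 2 * (b : ℂ) ^ 2 = -(ρ * σ) * (a ^ 2 - 9 * ρ) := mod_cast h2
      rw [branch, eq_div_iff (by simpa using hneC)]
      linear_combination (a ^ 2 - ρ * 4) * h2' - csqrt (a ^ 2 - 4 * ρ) * h1'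

theorem f3_ofReal {ρ σ a : ℝ} (h : 0 ≤ a ^ 2 - 4 * ρ)
    (hb : 0 ≤ branch ρ σ a √(a ^ 2 - 4 * ρ)) :
    f3 ρ σ a = (√(branch ρ σ a √(a ^ 2 - 4 * ρ)) : ℝ) := by
  have e : (a : ℂ) ^ 2 - ρ * 4 = ((a ^ 2 - 4 * ρ : ℝ) : ℂ) := by push_cast; ring
  rw [f3_eq, e, csqrt_ofReal h, branch_ofReal, csqrt_ofReal hb]

theorem f5_ofReal {ρ σ a : ℝ} (h : 0 ≤ a ^ 2 - 4 * ρ)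
    (hb : 0 ≤ branch ρ σ a (-√(a ^ 2 - 4 * ρ))) :
    f5 ρ σ a = (√(branch ρ σ a (-√(a ^ 2 - 4 * ρ))) : ℝ) := by
  have e : (a : ℂ) ^ 2 - ρ * 4 = ((a ^ 2 - 4 * ρ : ℝ) : ℂ) := by push_cast; ring
  rw [f5_eq, e, csqrt_ofReal h, ← Complex.ofReal_neg, branch_ofReal, csqrt_ofReal hb]

theorem sgn_ofReal (T : Subtypes) : ((sgn ℝ T : ℝ) : ℂ) = sgn ℂ T := by
  cases T <;> simp [sgn]

/-- For real `u` the condition `u² ≠ -4` is vacuous, so it may be imposed in the minus case too and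
the statement stays uniform. -/
theorem admissible_and_iff {T₁ T₂ : Subtypes} {u v : ℝ}
    (h : v ^ 2 ≠ 4 * sgn ℝ T₂ ↔ u ^ 2 ≠ 4 * sgn ℝ T₁) :
    Admissible T₁ u ∧ Admissible T₂ v ↔ u ^ 2 ≠ 4 * sgn ℝ T₁ := by
  rw [admissible_iff, admissible_iff]
  cases T₁
  · simp; tauto
  · have : u ^ 2 ≠ 4 * sgn ℝ .minus := by simp only [sgn]; nlinarith
    simp; tauto

theorem mem_P2_iff (T₁ T₂ : Subtypes) (p : ℂ × ℂ) : p ∈ P2 T₁ T₂ ↔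
    ∃ u v : ℝ, p = ((u : ℂ), (v : ℂ)) ∧ u ^ 2 ≠ 4 * sgn ℝ T₁ ∧
      (v ^ 2 = sgn ℝ T₁ * sgn ℝ T₂ * u ^ 2 ∨
      (4 * sgn ℝ T₁ < u ^ 2 ∧
        (v ^ 2 = branch (sgn ℝ T₁) (sgn ℝ T₂) u √(u ^ 2 - 4 * sgn ℝ T₁) ∨
        v ^ 2 = branch (sgn ℝ T₁) (sgn ℝ T₂) u (-√(u ^ 2 - 4 * sgn ℝ T₁)))) ∨
      (u ^ 2 < 4 * sgn ℝ T₁ ∧ u * (u ^ 2 - 3 * sgn ℝ T₁) = 0 ∧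
        2 * v ^ 2 = -(sgn ℝ T₁ * sgn ℝ T₂) * (u ^ 2 - 9 * sgn ℝ T₁))) := by
  refine exists_congr fun u => exists_congr fun v => and_congr_right fun _ => ?_
  rw [← exists_isTransform_ofReal_iff (sgn_sq _ _) (sgn_sq _ _), transporter_nonempty_iff,
    sgn_ofReal, sgn_ofReal, ← and_assoc]
  refine and_congr_left fun ⟨α, c, δ, h⟩ => ?_
  have := h.discrim_ne_zero_iff (sgn_sq _ _) (sgn_sq _ _)
  rw [← sgn_ofReal, ← sgn_ofReal] at this
  exact admissible_and_iff (mod_cast this)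

theorem mem_P3_iff (T₁ T₂ : Subtypes) (p : ℂ × ℂ) : p ∈ P3 T₁ T₂ ↔
    ∃ u v : ℝ, p = ((u : ℂ), (v : ℂ)) ∧ u ^ 2 ≠ 4 * sgn ℝ T₁ ∧
      ((sgn ℝ T₁ = sgn ℝ T₂ ∧ v = u) ∨
      ∃ q, q ^ 2 = u ^ 2 - 4 * sgn ℝ T₁ ∧ 0 < sgn ℝ T₂ * (q * (q - u)) ∧
        ((0 ≤ 3 * q - u ∧
          v = √(branch (sgn ℝ T₁) (sgn ℝ T₂) u (-(sgn ℝ T₁ * sgn ℝ T₂) * q))) ∨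
        (3 * q - u ≤ 0 ∧
          v = -√(branch (sgn ℝ T₁) (sgn ℝ T₂) u (-(sgn ℝ T₁ * sgn ℝ T₂) * q))))) := by
  refine exists_congr fun u => exists_congr fun v => and_congr_right fun _ => ?_
  rw [← exists_isTransform_real_iff (sgn_sq _ _) (sgn_sq _ _), transporter_nonempty_iff,
    ← and_assoc]
  refine and_congr_left fun ⟨α, c, δ, h⟩ => ?_
  exact admissible_and_iff (h.discrim_ne_zero_iff (sgn_sq _ _) (sgn_sq _ _))

/-! ### Joint graphs as real relations -/

/-- The set of pairs of real numbers in a relation, as a subset of `ℂ²`. -/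
def realPairs (R : ℝ → ℝ → Prop) : Set (ℂ × ℂ) :=
  {p | ∃ u v : ℝ, p = ((u : ℂ), (v : ℂ)) ∧ R u v}

theorem realPairs_union (R S : ℝ → ℝ → Prop) :
    realPairs R ∪ realPairs S = realPairs fun u v => R u v ∨ S u v := by
  ext p
  simp only [realPairs, Set.mem_union, Set.mem_ofPred_eq, and_or_left, exists_or]

theorem realPairs_congr {R S : ℝ → ℝ → Prop} (h : ∀ u v, R u v ↔ S u v) :
    realPairs R = realPairs S := by
  rw [show R = S from funext fun u => funext fun v => propext (h u v)]

theorem singleton_eq_realPairs (a b : ℝ) :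
    {((a : ℂ), (b : ℂ))} = realPairs fun u v => u = a ∧ v = b := by
  ext p
  simp only [realPairs, Set.mem_singleton_iff, Set.mem_ofPred_eq]
  exact ⟨fun h => ⟨a, b, h, rfl, rfl⟩, by rintro ⟨u, v, h, rfl, rfl⟩; exact h⟩

/-- The hypothesis includes that the values over `S` are real; set identities in `ℂ²` then reduce to
equivalences between relations on `ℝ`. -/
theorem jointGraph_realSet_eq {n : ℕ} (S : Set ℝ) (f : Fin n → ℂ → ℂ) (R : ℝ → ℝ → Prop)
    (h : ∀ u ∈ S, ∀ w : ℂ, (∃ i, w = f i u) ↔ ∃ v : ℝ, w = v ∧ R u v) :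
    jointGraph (realSet S) f = realPairs fun u v => u ∈ S ∧ R u v := by
  ext ⟨a, w⟩
  simp only [jointGraph, realSet, realPairs, Set.mem_ofPred_eq, Set.mem_image, Prod.mk.injEq]
  constructor
  · rintro ⟨⟨u, hu, rfl⟩, hw⟩
    obtain ⟨v, hv, hR⟩ := (h u hu w).1 hw
    exact ⟨u, v, ⟨rfl, hv⟩, hu, hR⟩
  · rintro ⟨u, v, ⟨rfl, rfl⟩, hu, hR⟩
    exact ⟨⟨u, hu, rfl⟩, (h u hu v).2 ⟨v, rfl, hR⟩⟩

theorem eq_or_eq_neg_iff_exists_real {w z : ℂ} {e : ℝ} (he : 0 ≤ e) (hz : z = (√e : ℝ)) :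
    w = z ∨ w = -z ↔ ∃ v : ℝ, w = v ∧ v ^ 2 = e := by
  constructor
  · rintro (rfl | rfl)
    · exact ⟨√e, hz, Real.sq_sqrt he⟩
    · exact ⟨-√e, by rw [hz]; simp, by rw [neg_sq, Real.sq_sqrt he]⟩
  · rintro ⟨v, rfl, hv⟩
    rw [hz, ← sq_eq_sq_iff_eq_or_eq_neg]
    have : v ^ 2 = √e ^ 2 := by rw [hv, Real.sq_sqrt he]
    exact_mod_cast this

section Graphs

variable {ρ σ : ℝ} {S : Set ℝ}

theorem jointGraph_f3_f4 (h0 : ∀ u ∈ S, 0 ≤ u ^ 2 - 4 * ρ)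
    (hb : ∀ u ∈ S, 0 ≤ branch ρ σ u √(u ^ 2 - 4 * ρ)) :
    jointGraph (realSet S) ![f3 ρ σ, f4 ρ σ] =
      realPairs fun u v => u ∈ S ∧ v ^ 2 = branch ρ σ u √(u ^ 2 - 4 * ρ) := by
  refine jointGraph_realSet_eq _ _ _ fun u hu w => ?_
  simp only [Fin.exists_fin_two, Matrix.cons_val_zero, Matrix.cons_val_one, f4_eq]
  exact eq_or_eq_neg_iff_exists_real (hb u hu) (f3_ofReal (h0 u hu) (hb u hu))

theorem jointGraph_f5_f6 (h0 : ∀ u ∈ S, 0 ≤ u ^ 2 - 4 * ρ)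
    (hb : ∀ u ∈ S, 0 ≤ branch ρ σ u (-√(u ^ 2 - 4 * ρ))) :
    jointGraph (realSet S) ![f5 ρ σ, f6 ρ σ] =
      realPairs fun u v => u ∈ S ∧ v ^ 2 = branch ρ σ u (-√(u ^ 2 - 4 * ρ)) := by
  refine jointGraph_realSet_eq _ _ _ fun u hu w => ?_
  simp only [Fin.exists_fin_two, Matrix.cons_val_zero, Matrix.cons_val_one, f6_eq]
  exact eq_or_eq_neg_iff_exists_real (hb u hu) (f5_ofReal (h0 u hu) (hb u hu))

theorem jointGraph_singleton {S : Set ℝ} {f : ℂ → ℂ} {g : ℝ → ℝ}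
    (h : ∀ u ∈ S, f u = (g u : ℝ)) :
    jointGraph (realSet S) ![f] = realPairs fun u v => u ∈ S ∧ v = g u := by
  refine jointGraph_realSet_eq _ _ _ fun u hu w => ?_
  simp only [Fin.exists_fin_one, Matrix.cons_val_fin_one, h u hu]
  exact ⟨fun h => ⟨_, h, rfl⟩, by rintro ⟨v, h, rfl⟩; exact h⟩

theorem jointGraph_f3 (h0 : ∀ u ∈ S, 0 ≤ u ^ 2 - 4 * ρ)
    (hb : ∀ u ∈ S, 0 ≤ branch ρ σ u √(u ^ 2 - 4 * ρ)) :
    jointGraph (realSet S) ![f3 ρ σ] =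
      realPairs fun u v => u ∈ S ∧ v = √(branch ρ σ u √(u ^ 2 - 4 * ρ)) :=
  jointGraph_singleton (f := f3 ρ σ) fun u hu => f3_ofReal (h0 u hu) (hb u hu)

theorem jointGraph_f4 (h0 : ∀ u ∈ S, 0 ≤ u ^ 2 - 4 * ρ)
    (hb : ∀ u ∈ S, 0 ≤ branch ρ σ u √(u ^ 2 - 4 * ρ)) :
    jointGraph (realSet S) ![f4 ρ σ] =
      realPairs fun u v => u ∈ S ∧ v = -√(branch ρ σ u √(u ^ 2 - 4 * ρ)) :=
  jointGraph_singleton (f := f4 ρ σ) (g := fun u => -√(branch ρ σ u √(u ^ 2 - 4 * ρ)))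
    fun u hu => by rw [f4_eq, f3_ofReal (h0 u hu) (hb u hu), Complex.ofReal_neg]

theorem jointGraph_f5 (h0 : ∀ u ∈ S, 0 ≤ u ^ 2 - 4 * ρ)
    (hb : ∀ u ∈ S, 0 ≤ branch ρ σ u (-√(u ^ 2 - 4 * ρ))) :
    jointGraph (realSet S) ![f5 ρ σ] =
      realPairs fun u v => u ∈ S ∧ v = √(branch ρ σ u (-√(u ^ 2 - 4 * ρ))) :=
  jointGraph_singleton (f := f5 ρ σ) fun u hu => f5_ofReal (h0 u hu) (hb u hu)

theorem jointGraph_f6 (h0 : ∀ u ∈ S, 0 ≤ u ^ 2 - 4 * ρ)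
    (hb : ∀ u ∈ S, 0 ≤ branch ρ σ u (-√(u ^ 2 - 4 * ρ))) :
    jointGraph (realSet S) ![f6 ρ σ] =
      realPairs fun u v => u ∈ S ∧ v = -√(branch ρ σ u (-√(u ^ 2 - 4 * ρ))) :=
  jointGraph_singleton (f := f6 ρ σ) (g := fun u => -√(branch ρ σ u (-√(u ^ 2 - 4 * ρ))))
    fun u hu => by rw [f6_eq, f5_ofReal (h0 u hu) (hb u hu), Complex.ofReal_neg]

theorem csqrt_one : csqrt 1 = 1 := by
  simpa using csqrt_ofReal zero_le_one

theorem f1_ofReal (hρσ : ρ * σ = 1) (a : ℝ) : f1 ρ σ a = a := by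
  rw [f1, ← Complex.ofReal_mul, hρσ, Complex.ofReal_one, csqrt_one, one_mul]

theorem jointGraph_f1 (hρσ : ρ * σ = 1) :
    jointGraph (realSet S) ![f1 ρ σ] = realPairs fun u v => u ∈ S ∧ v = u :=
  jointGraph_singleton (f := f1 ρ σ) fun u _ => f1_ofReal hρσ u

theorem jointGraph_f1_f2 (hρσ : ρ * σ = 1) :
    jointGraph (realSet S) ![f1 ρ σ, f2 ρ σ] =
      realPairs fun u v => u ∈ S ∧ v ^ 2 = u ^ 2 := by
  refine jointGraph_realSet_eq _ _ _ fun u _ w => ?_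
  have h : (ρ : ℂ) * σ = 1 := mod_cast hρσ
  simp only [Fin.exists_fin_two, Matrix.cons_val_zero, Matrix.cons_val_one, eq_f1_or_f2_iff, h,
    one_mul]
  constructor
  · intro hw
    rcases sq_eq_sq_iff_eq_or_eq_neg.1 hw with rfl | rfl
    · exact ⟨u, rfl, rfl⟩
    · exact ⟨-u, by simp, neg_sq u⟩
  · rintro ⟨v, rfl, hv⟩
    exact_mod_cast hv

theorem jointGraph_f3_f4_f5_f6 {S : Set ℂ} {ρ σ : ℂ} :
    jointGraph S ![f3 ρ σ, f4 ρ σ, f5 ρ σ, f6 ρ σ] =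
      jointGraph S ![f3 ρ σ, f4 ρ σ] ∪ jointGraph S ![f5 ρ σ, f6 ρ σ] := by
  ext p
  simp only [jointGraph, Set.mem_union, Set.mem_ofPred_eq, Fin.exists_fin_succ]
  simp
  tauto

theorem jointGraph_f3_f6 {S : Set ℂ} {ρ σ : ℂ} :
    jointGraph S ![f3 ρ σ, f6 ρ σ] = jointGraph S ![f3 ρ σ] ∪ jointGraph S ![f6 ρ σ] := by
  ext p
  simp only [jointGraph, Set.mem_union, Set.mem_ofPred_eq, Fin.exists_fin_succ]
  simp
  tauto

end Graphs

/-! ### Signs of the radicands -/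

theorem branch_nonneg {ρ σ a q q' : ℝ} (hρ : ρ ^ 2 = 1) (hσ : σ ^ 2 = 1)
    (hq : q ^ 2 = a ^ 2 - 4 * ρ) (hq' : q' = -(ρ * σ) * q) (h : 0 < σ * (q * (q - a))) :
    0 ≤ branch ρ σ a q' := by
  have hqq : q * (q - a) ≠ 0 := fun h0 => by simp [h0] at h
  rw [hq', branch_eq hρ hq (left_ne_zero_of_mul hqq) (right_ne_zero_of_mul hqq),
    show σ * (3 * q - a) ^ 2 / (2 * (q * (q - a))) = (3 * q - a) ^ 2 / (2 * (σ * (q * (q - a)))) by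
      rw [div_eq_div_iff (by simpa using hqq) (by linarith)]
      linear_combination 2 * (q * (q - a)) * (3 * q - a) ^ 2 * hσ]
  positivity

/-- Here the radicand is minus a square over a positive number, so it is a square only where it
vanishes. This is the source of the isolated points `(±ξ, 0)` in `P2` for two plus subtypes. -/
theorem sq_eq_branch_iff_of_neg {ρ σ a q q' v : ℝ} (hρ : ρ ^ 2 = 1) (hσ : σ ^ 2 = 1)
    (hq : q ^ 2 = a ^ 2 - 4 * ρ) (hq' : q' = -(ρ * σ) * q) (h : σ * (q * (q - a)) < 0) :
    v ^ 2 = branch ρ σ a q' ↔ v = 0 ∧ 3 * q = a := by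
  have hqq : q * (q - a) ≠ 0 := fun h0 => by simp [h0] at h
  rw [hq', branch_eq hρ hq (left_ne_zero_of_mul hqq) (right_ne_zero_of_mul hqq),
    eq_div_iff (by simpa using hqq)]
  constructor
  · intro hv
    have hv' : 2 * v ^ 2 * -(σ * (q * (q - a))) + (3 * q - a) ^ 2 = 0 := by
      linear_combination -σ * hv - (3 * q - a) ^ 2 * hσ
    have h1 : 0 ≤ 2 * v ^ 2 * -(σ * (q * (q - a))) := mul_nonneg (by positivity) (by linarith)
    have h2 : (3 * q - a) ^ 2 = 0 := by nlinarith [sq_nonneg (3 * q - a)]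
    have h3 : 2 * v ^ 2 * -(σ * (q * (q - a))) = 0 := by nlinarith [sq_nonneg (3 * q - a)]
    have h4 : v ^ 2 = 0 := by
      rcases mul_eq_zero.1 h3 with h | h
      · linarith
      · linarith
    exact ⟨pow_eq_zero_iff two_ne_zero |>.1 h4, by
      linarith [pow_eq_zero_iff two_ne_zero |>.1 h2]⟩
  · rintro ⟨rfl, rfl⟩
    ring

theorem xi_pos : 0 < xi := by unfold xi; positivity

theorem xi_sq : xi ^ 2 = 9 / 2 := by
  rw [xi, div_pow, Real.sq_sqrt zero_le_two]; norm_num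

theorem two_lt_xi : 2 < xi := by nlinarith [xi_pos, xi_sq]

theorem mem_Rprime_iff {a : ℝ} : a ∈ Rprime ↔ a ^ 2 ≠ 4 := by
  rw [show (4 : ℝ) = 2 ^ 2 by norm_num, Ne, sq_eq_sq_iff_eq_or_eq_neg]
  simp [Rprime, and_comm]

theorem P2_eq_realPairs (T₁ T₂ : Subtypes) : P2 T₁ T₂ = realPairs fun u v =>
    u ^ 2 ≠ 4 * sgn ℝ T₁ ∧
      (v ^ 2 = sgn ℝ T₁ * sgn ℝ T₂ * u ^ 2 ∨
      (4 * sgn ℝ T₁ < u ^ 2 ∧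
        (v ^ 2 = branch (sgn ℝ T₁) (sgn ℝ T₂) u √(u ^ 2 - 4 * sgn ℝ T₁) ∨
        v ^ 2 = branch (sgn ℝ T₁) (sgn ℝ T₂) u (-√(u ^ 2 - 4 * sgn ℝ T₁)))) ∨
      (u ^ 2 < 4 * sgn ℝ T₁ ∧ u * (u ^ 2 - 3 * sgn ℝ T₁) = 0 ∧
        2 * v ^ 2 = -(sgn ℝ T₁ * sgn ℝ T₂) * (u ^ 2 - 9 * sgn ℝ T₁))) :=
  Set.ext fun p => mem_P2_iff T₁ T₂ p

theorem P3_eq_realPairs (T₁ T₂ : Subtypes) : P3 T₁ T₂ = realPairs fun u v =>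
    u ^ 2 ≠ 4 * sgn ℝ T₁ ∧
      ((sgn ℝ T₁ = sgn ℝ T₂ ∧ v = u) ∨
      ∃ q, q ^ 2 = u ^ 2 - 4 * sgn ℝ T₁ ∧ 0 < sgn ℝ T₂ * (q * (q - u)) ∧
        ((0 ≤ 3 * q - u ∧
          v = √(branch (sgn ℝ T₁) (sgn ℝ T₂) u (-(sgn ℝ T₁ * sgn ℝ T₂) * q))) ∨
        (3 * q - u ≤ 0 ∧
          v = -√(branch (sgn ℝ T₁) (sgn ℝ T₂) u (-(sgn ℝ T₁ * sgn ℝ T₂) * q))))) :=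
  Set.ext fun p => mem_P3_iff T₁ T₂ p

section RealRoots

variable {u : ℝ}

theorem sqrt_bounds_of_two_lt (h : 2 < u) :
    0 < √(u ^ 2 - 4 * 1) ∧ √(u ^ 2 - 4 * 1) < u ∧ √(u ^ 2 - 4 * 1) ^ 2 = u ^ 2 - 4 * 1 :=
  ⟨Real.sqrt_pos.2 (by nlinarith), (Real.sqrt_lt' (by linarith)).2 (by linarith),
    Real.sq_sqrt (by nlinarith)⟩

theorem sqrt_bounds_of_lt_neg_two (h : u < -2) :
    0 < √(u ^ 2 - 4 * 1) ∧ √(u ^ 2 - 4 * 1) < -u ∧ √(u ^ 2 - 4 * 1) ^ 2 = u ^ 2 - 4 * 1 :=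
  ⟨Real.sqrt_pos.2 (by nlinarith), (Real.sqrt_lt' (by linarith)).2 (by linarith),
    Real.sq_sqrt (by nlinarith)⟩

theorem sqrt_bounds_neg_one (u : ℝ) :
    0 < √(u ^ 2 - 4 * -1) ∧ u < √(u ^ 2 - 4 * -1) ∧ -u < √(u ^ 2 - 4 * -1) ∧
      √(u ^ 2 - 4 * -1) ^ 2 = u ^ 2 - 4 * -1 :=
  ⟨Real.sqrt_pos.2 (by nlinarith), Real.lt_sqrt_of_sq_lt (by linarith),
    Real.lt_sqrt_of_sq_lt (by linarith), Real.sq_sqrt (by nlinarith)⟩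

theorem two_lt_or_lt_neg_two (h : 4 * 1 < u ^ 2) : 2 < u ∨ u < -2 := by
  by_contra! h'
  nlinarith

theorem eq_xi_of_sq_eq {q : ℝ} (h : 0 < u) (hq : q ^ 2 = u ^ 2 - 4 * 1) (h3 : 9 * q ^ 2 = u ^ 2) :
    u = xi :=
  (pow_left_inj₀ h.le xi_pos.le two_ne_zero).1 (by rw [xi_sq]; linarith)

theorem three_mul_sqrt_xi : 3 * √(xi ^ 2 - 4 * 1) = xi := by
  obtain ⟨h0, -, h2⟩ := sqrt_bounds_of_two_lt two_lt_xi
  have h := xi_sq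
  exact (pow_left_inj₀ (by linarith) xi_pos.le two_ne_zero).1 (by rw [mul_pow, h2, h]; norm_num)

/-- Signs of the branches over `u > 2` for `ρ = σ = 1`. -/
theorem branch_one_one_of_two_lt (h : 2 < u) :
    0 ≤ branch 1 1 u √(u ^ 2 - 4 * 1) ∧
      ∀ v, v ^ 2 = branch 1 1 u (-√(u ^ 2 - 4 * 1)) ↔ v = 0 ∧ u = xi := by
  obtain ⟨h0, h1, h2⟩ := sqrt_bounds_of_two_lt h
  refine ⟨branch_nonneg (q := -√(u ^ 2 - 4 * 1)) (by norm_num) (by norm_num) (by linarith)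
    (by ring) (by nlinarith), fun v => ?_⟩
  rw [sq_eq_branch_iff_of_neg (q := √(u ^ 2 - 4 * 1)) (by norm_num) (by norm_num) h2
    (by ring) (by nlinarith)]
  refine and_congr_right fun _ => ⟨fun h3 => eq_xi_of_sq_eq (by linarith) h2 (by
    linear_combination (3 * √(u ^ 2 - 4 * 1) + u) * h3), ?_⟩
  rintro rfl
  exact three_mul_sqrt_xi

/-- Apart from `a²`, only the product `a q` enters. The reflection `a ↦ -a` therefore exchanges the
two branches, and the results for `u < -2` follow from those for `u > 2`. -/
theorem branch_neg_left {ρ σ a q : ℝ} : branch ρ σ (-a) q = branch ρ σ a (-q) := by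
  simp [branch]

/-- Signs of the branches over `u < -2` for `ρ = σ = 1`. -/
theorem branch_one_one_of_lt_neg_two (h : u < -2) :
    0 ≤ branch 1 1 u (-√(u ^ 2 - 4 * 1)) ∧
      ∀ v, v ^ 2 = branch 1 1 u √(u ^ 2 - 4 * 1) ↔ v = 0 ∧ u = -xi := by
  have := branch_one_one_of_two_lt (u := -u) (by linarith)
  simp only [neg_sq, branch_neg_left, neg_neg, neg_eq_iff_eq_neg] at this
  exact this

/-- Signs of the branches over `u > 2` for `ρ = 1`, `σ = -1`. -/
theorem branch_one_neg_one_of_two_lt (h : 2 < u) :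
    0 ≤ branch 1 (-1) u √(u ^ 2 - 4 * 1) ∧
      ∀ v, ¬ v ^ 2 = branch 1 (-1) u (-√(u ^ 2 - 4 * 1)) := by
  obtain ⟨h0, h1, h2⟩ := sqrt_bounds_of_two_lt h
  refine ⟨branch_nonneg (q := √(u ^ 2 - 4 * 1)) (by norm_num) (by norm_num) (by linarith)
    (by ring) (by nlinarith), fun v => ?_⟩
  rw [sq_eq_branch_iff_of_neg (q := -√(u ^ 2 - 4 * 1)) (by norm_num) (by norm_num)
    (by linarith) (by ring) (by nlinarith)]
  rintro ⟨-, h3⟩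
  linarith

/-- Signs of the branches over `u < -2` for `ρ = 1`, `σ = -1`. -/
theorem branch_one_neg_one_of_lt_neg_two (h : u < -2) :
    0 ≤ branch 1 (-1) u (-√(u ^ 2 - 4 * 1)) ∧
      ∀ v, ¬ v ^ 2 = branch 1 (-1) u √(u ^ 2 - 4 * 1) := by
  have := branch_one_neg_one_of_two_lt (u := -u) (by linarith)
  simpa only [neg_sq, branch_neg_left, neg_neg] using this

/-- Since `|u| < √(u² + 4)`, both roots satisfy `q (q - u) > 0`, which `σ = -1` makes negative, and
`3 q = u` is impossible. -/
theorem sq_ne_branch_neg_one_neg_one (u v : ℝ) :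
    ¬ v ^ 2 = branch (-1) (-1) u √(u ^ 2 - 4 * -1) := by
  obtain ⟨h0, h1, h2, h3⟩ := sqrt_bounds_neg_one u
  rw [sq_eq_branch_iff_of_neg (q := -√(u ^ 2 - 4 * -1)) (by norm_num) (by norm_num)
    (by linarith) (by ring) (by nlinarith)]
  rintro ⟨-, h4⟩
  linarith

theorem sq_ne_branch_neg_one_neg_one_neg (u v : ℝ) :
    ¬ v ^ 2 = branch (-1) (-1) u (-√(u ^ 2 - 4 * -1)) := by
  simpa only [neg_sq, branch_neg_left] using sq_ne_branch_neg_one_neg_one (-u) v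

theorem branch_neg_one_one_nonneg (u : ℝ) : 0 ≤ branch (-1) 1 u √(u ^ 2 - 4 * -1) := by
  obtain ⟨h0, h1, h2, h3⟩ := sqrt_bounds_neg_one u
  exact branch_nonneg (q := √(u ^ 2 - 4 * -1)) (by norm_num) (by norm_num) (by linarith)
    (by ring) (by nlinarith)

theorem branch_neg_one_one_nonneg_neg (u : ℝ) : 0 ≤ branch (-1) 1 u (-√(u ^ 2 - 4 * -1)) := by
  simpa only [neg_sq, branch_neg_left] using branch_neg_one_one_nonneg (-u)

/-- The real solutions of the equivalence relation over a square root of `u² - 4ρ`. -/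
theorem exists_root_iff {P : ℝ → Prop} {d : ℝ} (hd : 0 ≤ d) :
    (∃ q, q ^ 2 = d ∧ P q) ↔ P √d ∨ P (-√d) := by
  constructor
  · rintro ⟨q, hq, h⟩
    rw [← Real.sq_sqrt hd] at hq
    rcases sq_eq_sq_iff_eq_or_eq_neg.1 hq with rfl | rfl
    · exact Or.inl h
    · exact Or.inr h
  · rintro (h | h)
    · exact ⟨_, Real.sq_sqrt hd, h⟩
    · exact ⟨_, by rw [neg_sq, Real.sq_sqrt hd], h⟩

end RealRoots

/-! ### The sets `P2` and `P3` -/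

theorem P2_plus_plus : P2 .plus .plus =
    jointGraph (realSet Rprime) ![f1 1 1, f2 1 1]
      ∪ jointGraph (realSet (Set.Ioi 2)) ![f3 1 1, f4 1 1]
      ∪ jointGraph (realSet (Set.Iio (-2))) ![f5 1 1, f6 1 1]
      ∪ {((0 : ℂ), (((-xi : ℝ)) : ℂ)), ((0 : ℂ), (xi : ℂ))}
      ∪ {(((-xi : ℝ) : ℂ), (0 : ℂ)), ((xi : ℂ), (0 : ℂ))} := by
  have h12 := jointGraph_f1_f2 (ρ := 1) (σ := 1) (S := Rprime) (by norm_num)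
  have h34 := jointGraph_f3_f4 (ρ := 1) (σ := 1) (S := Set.Ioi 2)
    (fun u (hu : 2 < u) => by nlinarith) fun u hu => (branch_one_one_of_two_lt hu).1
  have h56 := jointGraph_f5_f6 (ρ := 1) (σ := 1) (S := Set.Iio (-2))
    (fun u (hu : u < -2) => by nlinarith) fun u hu => (branch_one_one_of_lt_neg_two hu).1
  simp only [Complex.ofReal_one] at h12 h34 h56
  rw [P2_eq_realPairs, h12, h34, h56, Set.insert_eq, Set.insert_eq, ← Complex.ofReal_zero]
  simp only [singleton_eq_realPairs, realPairs_union, sgn]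
  refine realPairs_congr fun u v => ?_
  simp only [mem_Rprime_iff, Set.mem_Ioi, Set.mem_Iio]
  have hxi := xi_sq
  have hxi2 := two_lt_xi
  constructor
  · rintro ⟨h0, h | ⟨hu, h⟩ | ⟨hu, h1, h2⟩⟩
    · exact Or.inl <| Or.inl <| Or.inl <| Or.inl ⟨by simpa using h0, by linarith⟩
    · rcases two_lt_or_lt_neg_two hu with hu | hu
      · rw [(branch_one_one_of_two_lt hu).2] at h
        tauto
      · rw [(branch_one_one_of_lt_neg_two hu).2] at h
        tauto
    -- The imaginary root leaves `u = 0`, giving `v = ±ξ`, and `u² = 3`, giving `v² = 3 = u²`, which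
    -- `f₁` and `f₂` already cover.
    · rcases mul_eq_zero.1 h1 with h3 | h3
      · have h4 : v ^ 2 = xi ^ 2 := by rw [h3] at h2; linarith
        rcases sq_eq_sq_iff_eq_or_eq_neg.1 h4 with h5 | h5 <;> tauto
      · exact Or.inl <| Or.inl <| Or.inl <| Or.inl ⟨by simpa using h0, by linarith⟩
  · rintro ((((⟨h0, h⟩ | ⟨hu, h⟩) | ⟨hu, h⟩) | ⟨rfl, h⟩ | ⟨rfl, h⟩) | ⟨rfl, h⟩ | ⟨rfl, h⟩)
    · exact ⟨by simpa using h0, Or.inl (by linarith)⟩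
    · exact ⟨by nlinarith, Or.inr <| Or.inl ⟨by nlinarith, Or.inl h⟩⟩
    · exact ⟨by nlinarith, Or.inr <| Or.inl ⟨by nlinarith, Or.inr h⟩⟩
    · exact ⟨by norm_num, Or.inr <| Or.inr ⟨by norm_num, by norm_num, by rw [h]; linarith⟩⟩
    · exact ⟨by norm_num, Or.inr <| Or.inr ⟨by norm_num, by norm_num, by rw [h]; linarith⟩⟩
    · exact ⟨by nlinarith, Or.inr <| Or.inl ⟨by nlinarith,
        Or.inl (((branch_one_one_of_lt_neg_two (by linarith)).2 v).2 ⟨h, rfl⟩)⟩⟩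
    · exact ⟨by nlinarith, Or.inr <| Or.inl ⟨by nlinarith,
        Or.inr (((branch_one_one_of_two_lt (by linarith)).2 v).2 ⟨h, rfl⟩)⟩⟩

theorem P3_plus_plus : P3 .plus .plus =
    jointGraph (realSet Rprime) ![f1 1 1]
      ∪ jointGraph (realSet (Set.Ioi 2)) ![f4 1 1]
      ∪ jointGraph (realSet (Set.Iio (-2))) ![f5 1 1] := by
  have h1 := jointGraph_f1 (ρ := 1) (σ := 1) (S := Rprime) (by norm_num)
  have h4 := jointGraph_f4 (ρ := 1) (σ := 1) (S := Set.Ioi 2)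
    (fun u (hu : 2 < u) => by nlinarith) fun u hu => (branch_one_one_of_two_lt hu).1
  have h5 := jointGraph_f5 (ρ := 1) (σ := 1) (S := Set.Iio (-2))
    (fun u (hu : u < -2) => by nlinarith) fun u hu => (branch_one_one_of_lt_neg_two hu).1
  simp only [Complex.ofReal_one] at h1 h4 h5
  rw [P3_eq_realPairs, h1, h4, h5]
  simp only [realPairs_union, sgn]
  refine realPairs_congr fun u v => ?_
  simp only [mem_Rprime_iff, Set.mem_Ioi, Set.mem_Iio]
  by_cases hu : 4 * 1 < u ^ 2
  · rw [exists_root_iff (by linarith)]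
    rcases two_lt_or_lt_neg_two hu with hu' | hu'
    · obtain ⟨q0, q1, q2⟩ := sqrt_bounds_of_two_lt hu'
      -- Only the root of sign opposite to `u` makes `q (q - u)` positive; it also makes `3 q - u`
      -- negative for `u > 2`, which selects `f₄`.
      have e1 : ¬ 0 < 1 * (√(u ^ 2 - 4 * 1) * (√(u ^ 2 - 4 * 1) - u)) := by nlinarith
      have e2 : 0 < 1 * (-√(u ^ 2 - 4 * 1) * (-√(u ^ 2 - 4 * 1) - u)) := by nlinarith
      have e3 : ¬ 0 ≤ 3 * -√(u ^ 2 - 4 * 1) - u := by linarith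
      have e4 : 3 * -√(u ^ 2 - 4 * 1) - u ≤ 0 := by linarith
      have e5 : ¬ u < -2 := by linarith
      have e6 : u ^ 2 ≠ 4 := by linarith
      simp only [e1, e2, e3, e4, e5, hu']
      simp [e6]
    · obtain ⟨q0, q1, q2⟩ := sqrt_bounds_of_lt_neg_two hu'
      have e1 : 0 < 1 * (√(u ^ 2 - 4 * 1) * (√(u ^ 2 - 4 * 1) - u)) := by nlinarith
      have e2 : ¬ 0 < 1 * (-√(u ^ 2 - 4 * 1) * (-√(u ^ 2 - 4 * 1) - u)) := by nlinarith
      have e3 : 0 ≤ 3 * √(u ^ 2 - 4 * 1) - u := by linarith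
      have e4 : ¬ 3 * √(u ^ 2 - 4 * 1) - u ≤ 0 := by linarith
      have e5 : ¬ 2 < u := by linarith
      have e6 : u ^ 2 ≠ 4 := by linarith
      simp only [e1, e2, e3, e4, e5, hu']
      simp [e6]
  · constructor
    · rintro ⟨h0, ⟨-, h⟩ | ⟨q, hq, h, -⟩⟩
      · exact Or.inl <| Or.inl ⟨by simpa using h0, h⟩
      · exact absurd (le_antisymm (by linarith) (by nlinarith)) h0
    · rintro ((⟨h0, h⟩ | ⟨hu', h⟩) | ⟨hu', h⟩)
      · exact ⟨by simpa using h0, Or.inl ⟨trivial, h⟩⟩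
      · exact absurd (by nlinarith) hu
      · exact absurd (by nlinarith) hu

theorem P2_minus_minus :
    P2 .minus .minus = jointGraph (realSet Set.univ) ![f1 (-1) (-1), f2 (-1) (-1)] := by
  have h12 := jointGraph_f1_f2 (ρ := -1) (σ := -1) (S := Set.univ) (by norm_num)
  simp only [Complex.ofReal_one, Complex.ofReal_neg] at h12
  rw [P2_eq_realPairs, h12]
  refine realPairs_congr fun u v => ?_
  have e1 : ¬ u ^ 2 < 4 * -1 := by nlinarith
  have e2 : ¬ u ^ 2 = 4 * -1 := by nlinarith
  simp only [sgn, sq_ne_branch_neg_one_neg_one, sq_ne_branch_neg_one_neg_one_neg, e1, ne_eq, e2]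
  simp

theorem P3_minus_minus :
    P3 .minus .minus = jointGraph (realSet Set.univ) ![f1 (-1) (-1)] := by
  have h1 := jointGraph_f1 (ρ := -1) (σ := -1) (S := Set.univ) (by norm_num)
  simp only [Complex.ofReal_one, Complex.ofReal_neg] at h1
  rw [P3_eq_realPairs, h1]
  refine realPairs_congr fun u v => ?_
  simp only [sgn]
  rw [exists_root_iff (by nlinarith)]
  obtain ⟨q0, q1, q2, q3⟩ := sqrt_bounds_neg_one u
  have e1 : ¬ 0 < -1 * (√(u ^ 2 - 4 * -1) * (√(u ^ 2 - 4 * -1) - u)) := by nlinarith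
  have e2 : ¬ 0 < -1 * (-√(u ^ 2 - 4 * -1) * (-√(u ^ 2 - 4 * -1) - u)) := by nlinarith
  have e3 : ¬ u ^ 2 = 4 * -1 := by nlinarith
  simp only [e1, e2, e3, ne_eq]
  simp

theorem P2_plus_minus : P2 .plus .minus =
    {((0 : ℂ), (0 : ℂ))}
      ∪ jointGraph (realSet (Set.Ioi 2)) ![f3 1 (-1), f4 1 (-1)]
      ∪ jointGraph (realSet (Set.Iio (-2))) ![f5 1 (-1), f6 1 (-1)] := by
  have h34 := jointGraph_f3_f4 (ρ := 1) (σ := -1) (S := Set.Ioi 2)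
    (fun u (hu : 2 < u) => by nlinarith) fun u hu => (branch_one_neg_one_of_two_lt hu).1
  have h56 := jointGraph_f5_f6 (ρ := 1) (σ := -1) (S := Set.Iio (-2))
    (fun u (hu : u < -2) => by nlinarith) fun u hu => (branch_one_neg_one_of_lt_neg_two hu).1
  simp only [Complex.ofReal_one, Complex.ofReal_neg] at h34 h56
  rw [P2_eq_realPairs, h34, h56, ← Complex.ofReal_zero]
  simp only [singleton_eq_realPairs, realPairs_union, sgn]
  refine realPairs_congr fun u v => ?_
  simp only [Set.mem_Ioi, Set.mem_Iio]
  constructor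
  · rintro ⟨h0, h | ⟨hu, h⟩ | ⟨hu, h1, h2⟩⟩
    · exact Or.inl <| Or.inl ⟨by nlinarith, by nlinarith⟩
    · rcases two_lt_or_lt_neg_two hu with hu | hu
      · have := (branch_one_neg_one_of_two_lt hu).2 v
        tauto
      · have := (branch_one_neg_one_of_lt_neg_two hu).2 v
        tauto
    -- Here `2 v² = u² - 9` with `u² < 4`, which is impossible.
    · nlinarith
  · rintro ((⟨rfl, rfl⟩ | ⟨hu, h⟩) | ⟨hu, h⟩)
    · exact ⟨by norm_num, Or.inl (by norm_num)⟩
    · exact ⟨by nlinarith, Or.inr <| Or.inl ⟨by nlinarith, Or.inl h⟩⟩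
    · exact ⟨by nlinarith, Or.inr <| Or.inl ⟨by nlinarith, Or.inr h⟩⟩

theorem branch_one_neg_one_xi : branch 1 (-1) xi √(xi ^ 2 - 4 * 1) = 0 := by
  obtain ⟨h0, h1, h2⟩ := sqrt_bounds_of_two_lt two_lt_xi
  have := branch_eq (ρ := 1) (σ := -1) (by norm_num) h2 h0.ne' (by linarith)
  rw [three_mul_sqrt_xi, sub_self] at this
  simpa using this

/-- The `ℝ`-equivalence relation of `J₁₀⁺(u)` and `J₁₀⁻(v)` over `u > 2`. -/
theorem real_equiv_plus_minus_iff_of_two_lt {u : ℝ} (hu : 2 < u) (v : ℝ) :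
    ((0 ≤ 3 * √(u ^ 2 - 4 * 1) - u ∧ v = √(branch 1 (-1) u √(u ^ 2 - 4 * 1))) ∨
      (3 * √(u ^ 2 - 4 * 1) - u ≤ 0 ∧ v = -√(branch 1 (-1) u √(u ^ 2 - 4 * 1)))) ↔
    ((xi < u ∧ v = √(branch 1 (-1) u √(u ^ 2 - 4 * 1))) ∨
      (u < xi ∧ v = -√(branch 1 (-1) u √(u ^ 2 - 4 * 1)))) ∨ (u = xi ∧ v = 0) := by
  obtain ⟨q0, q1, q2⟩ := sqrt_bounds_of_two_lt hu
  have hxi := xi_sq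
  have hxi0 := xi_pos
  rcases lt_trichotomy u xi with h | rfl | h
  · have e1 : 3 * √(u ^ 2 - 4 * 1) - u < 0 := by
      have : u ^ 2 < xi ^ 2 := by nlinarith
      nlinarith
    simp only [e1.not_ge, e1.le, h, h.not_gt, h.ne, true_and, false_and, false_or, or_false]
  · rw [branch_one_neg_one_xi, three_mul_sqrt_xi]
    simp
  · have e1 : 0 < 3 * √(u ^ 2 - 4 * 1) - u := by
      have : xi ^ 2 < u ^ 2 := by nlinarith
      nlinarith
    simp only [e1.not_ge, e1.le, h, h.not_gt, h.ne', true_and, false_and, or_false]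

/-- The `ℝ`-equivalence relation of `J₁₀⁺(u)` and `J₁₀⁻(v)` over `u < -2`. -/
theorem real_equiv_plus_minus_iff_of_lt_neg_two {u : ℝ} (hu : u < -2) (v : ℝ) :
    ((0 ≤ 3 * -√(u ^ 2 - 4 * 1) - u ∧ v = √(branch 1 (-1) u (-√(u ^ 2 - 4 * 1)))) ∨
      (3 * -√(u ^ 2 - 4 * 1) - u ≤ 0 ∧ v = -√(branch 1 (-1) u (-√(u ^ 2 - 4 * 1))))) ↔
    ((-xi < u ∧ v = √(branch 1 (-1) u (-√(u ^ 2 - 4 * 1)))) ∨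
      (u < -xi ∧ v = -√(branch 1 (-1) u (-√(u ^ 2 - 4 * 1))))) ∨ (u = -xi ∧ v = 0) := by
  have h := real_equiv_plus_minus_iff_of_two_lt (u := -u) (by linarith) (-v)
  simp only [neg_sq, branch_neg_left, neg_eq_iff_eq_neg (a := v), neg_eq_iff_eq_neg (a := u),
    neg_lt (a := u), lt_neg (b := u), neg_neg, neg_zero] at h
  have e1 : 0 ≤ 3 * -√(u ^ 2 - 4 * 1) - u ↔ 3 * √(u ^ 2 - 4 * 1) - -u ≤ 0 := by
    constructor <;> intro <;> linarith
  have e2 : 3 * -√(u ^ 2 - 4 * 1) - u ≤ 0 ↔ 0 ≤ 3 * √(u ^ 2 - 4 * 1) - -u := by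
    constructor <;> intro <;> linarith
  rw [e1, e2, or_comm, h, or_comm (a := u < -xi ∧ _)]

theorem P3_plus_minus : P3 .plus .minus =
    jointGraph (realSet I1) ![f3 1 (-1)]
      ∪ jointGraph (realSet I2) ![f4 1 (-1)]
      ∪ jointGraph (realSet I3) ![f5 1 (-1)]
      ∪ jointGraph (realSet I4) ![f6 1 (-1)]
      ∪ {(((-xi : ℝ) : ℂ), (0 : ℂ)), ((xi : ℂ), (0 : ℂ))} := by
  have hxi := two_lt_xi
  have h1 : ∀ u ∈ I1, 2 < u := fun u hu => hxi.trans hu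
  have h2 : ∀ u ∈ I2, 2 < u := fun u hu => hu.1
  have h3 : ∀ u ∈ I3, u < -2 := fun u hu => hu.2
  have h4 : ∀ u ∈ I4, u < -2 := fun u (hu : u < -xi) => by linarith
  have g3 := jointGraph_f3 (ρ := 1) (σ := -1) (S := I1)
    (fun u hu => by nlinarith [h1 u hu]) fun u hu => (branch_one_neg_one_of_two_lt (h1 u hu)).1
  have g4 := jointGraph_f4 (ρ := 1) (σ := -1) (S := I2)
    (fun u hu => by nlinarith [h2 u hu]) fun u hu => (branch_one_neg_one_of_two_lt (h2 u hu)).1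
  have g5 := jointGraph_f5 (ρ := 1) (σ := -1) (S := I3)
    (fun u hu => by nlinarith [h3 u hu])
    fun u hu => (branch_one_neg_one_of_lt_neg_two (h3 u hu)).1
  have g6 := jointGraph_f6 (ρ := 1) (σ := -1) (S := I4)
    (fun u hu => by nlinarith [h4 u hu])
    fun u hu => (branch_one_neg_one_of_lt_neg_two (h4 u hu)).1
  simp only [Complex.ofReal_one, Complex.ofReal_neg] at g3 g4 g5 g6
  rw [P3_eq_realPairs, g3, g4, g5, g6, Set.insert_eq, ← Complex.ofReal_zero]
  simp only [singleton_eq_realPairs, realPairs_union, sgn]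
  refine realPairs_congr fun u v => ?_
  have m1 : u ∈ I1 ↔ xi < u := Iff.rfl
  have m2 : u ∈ I2 ↔ 2 < u ∧ u < xi := Iff.rfl
  have m3 : u ∈ I3 ↔ -xi < u ∧ u < -2 := Iff.rfl
  have m4 : u ∈ I4 ↔ u < -xi := Iff.rfl
  have e0 : (1 : ℝ) ≠ -1 := by norm_num
  simp only [m1, m2, m3, m4, e0, one_mul, neg_neg, false_and, false_or]
  by_cases hu : 4 * 1 < u ^ 2
  · have e2 : u ^ 2 ≠ 4 := by linarith
    rw [exists_root_iff (by linarith)]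
    rcases two_lt_or_lt_neg_two hu with hu' | hu'
    · obtain ⟨q0, q1, q2⟩ := sqrt_bounds_of_two_lt hu'
      -- With `σ = -1` the root must lie strictly between `0` and `u`; the sign of `3 q - u` then
      -- depends on the side of `ξ`.
      have e3 : 0 < -1 * (√(u ^ 2 - 4 * 1) * (√(u ^ 2 - 4 * 1) - u)) := by nlinarith
      have e4 : ¬ 0 < -1 * (-√(u ^ 2 - 4 * 1) * (-√(u ^ 2 - 4 * 1) - u)) := by nlinarith
      have e5 : ¬ u < -2 := by linarith
      have e6 : ¬ u < -xi := by linarith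
      have e7 : u ≠ -xi := by linarith
      simp only [e3, e4, true_and, false_and, or_false,
        real_equiv_plus_minus_iff_of_two_lt hu' v, e5, e6, e7, hu', and_false, false_or]
      simp [e2]
    · obtain ⟨q0, q1, q2⟩ := sqrt_bounds_of_lt_neg_two hu'
      have e3 : ¬ 0 < -1 * (√(u ^ 2 - 4 * 1) * (√(u ^ 2 - 4 * 1) - u)) := by nlinarith
      have e4 : 0 < -1 * (-√(u ^ 2 - 4 * 1) * (-√(u ^ 2 - 4 * 1) - u)) := by nlinarith
      have e5 : ¬ 2 < u := by linarith
      have e6 : ¬ xi < u := by linarith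
      have e7 : u ≠ xi := by linarith
      simp only [e3, e4, true_and, false_and, false_or,
        real_equiv_plus_minus_iff_of_lt_neg_two hu' v, e5, e6, e7, hu', and_true, or_false]
      simp [e2]
  · have e3 : ¬ 2 < u := fun h => hu (by nlinarith)
    have e4 : ¬ u < -2 := fun h => hu (by nlinarith)
    constructor
    · rintro ⟨h0, q, hq, -⟩
      exact absurd (le_antisymm (by linarith) (by nlinarith)) h0
    · rintro ((((⟨h, -⟩ | ⟨h, -⟩) | ⟨h, -⟩) | ⟨h, -⟩) | ⟨h, -⟩ | ⟨h, -⟩)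
      · exact absurd (hxi.trans h) e3
      · exact absurd h.1 e3
      · exact absurd h.2 e4
      · exact absurd (by linarith) e4
      · exact absurd (by linarith) e4
      · exact absurd (by linarith) e3

theorem P2_minus_plus : P2 .minus .plus =
    {((0 : ℂ), (0 : ℂ))}
      ∪ jointGraph (realSet Set.univ) ![f3 (-1) 1, f4 (-1) 1, f5 (-1) 1, f6 (-1) 1] := by
  have h34 := jointGraph_f3_f4 (ρ := -1) (σ := 1) (S := Set.univ)
    (fun u _ => by nlinarith) fun u _ => branch_neg_one_one_nonneg u
  have h56 := jointGraph_f5_f6 (ρ := -1) (σ := 1) (S := Set.univ)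
    (fun u _ => by nlinarith) fun u _ => branch_neg_one_one_nonneg_neg u
  simp only [Complex.ofReal_one, Complex.ofReal_neg] at h34 h56
  rw [P2_eq_realPairs, jointGraph_f3_f4_f5_f6, h34, h56, ← Complex.ofReal_zero]
  simp only [singleton_eq_realPairs, realPairs_union, sgn]
  refine realPairs_congr fun u v => ?_
  have e1 : ¬ u ^ 2 < 4 * -1 := by nlinarith
  have e2 : ¬ u ^ 2 = 4 * -1 := by nlinarith
  have e3 : 4 * -1 < u ^ 2 := by nlinarith
  have e4 : v ^ 2 = -1 * 1 * u ^ 2 ↔ u = 0 ∧ v = 0 :=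
    ⟨fun h => ⟨by nlinarith, by nlinarith⟩, by rintro ⟨rfl, rfl⟩; norm_num⟩
  simp only [e1, e2, e3, e4, Set.mem_univ, true_and, false_and, or_false, ne_eq,
    not_false_eq_true]

theorem P3_minus_plus :
    P3 .minus .plus = jointGraph (realSet Set.univ) ![f3 (-1) 1, f6 (-1) 1] := by
  have h3 := jointGraph_f3 (ρ := -1) (σ := 1) (S := Set.univ)
    (fun u _ => by nlinarith) fun u _ => branch_neg_one_one_nonneg u
  have h6 := jointGraph_f6 (ρ := -1) (σ := 1) (S := Set.univ)
    (fun u _ => by nlinarith) fun u _ => branch_neg_one_one_nonneg_neg u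
  simp only [Complex.ofReal_one, Complex.ofReal_neg] at h3 h6
  rw [P3_eq_realPairs, jointGraph_f3_f6, h3, h6]
  simp only [realPairs_union, sgn]
  refine realPairs_congr fun u v => ?_
  rw [exists_root_iff (by nlinarith)]
  obtain ⟨q0, q1, q2, q3⟩ := sqrt_bounds_neg_one u
  -- Both roots are allowed, and `|u| < |q|` gives `3 q - u` the sign of `q`: the positive root
  -- yields `f₃`, the negative one `f₆`.
  have e1 : 0 < 1 * (√(u ^ 2 - 4 * -1) * (√(u ^ 2 - 4 * -1) - u)) := by nlinarith
  have e2 : 0 < 1 * (-√(u ^ 2 - 4 * -1) * (-√(u ^ 2 - 4 * -1) - u)) := by nlinarith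
  have e3 : ¬ u ^ 2 = 4 * -1 := by nlinarith
  have e4 : 0 ≤ 3 * √(u ^ 2 - 4 * -1) - u := by linarith
  have e5 : ¬ 3 * √(u ^ 2 - 4 * -1) - u ≤ 0 := by linarith
  have e6 : 3 * -√(u ^ 2 - 4 * -1) - u ≤ 0 := by linarith
  have e7 : ¬ 0 ≤ 3 * -√(u ^ 2 - 4 * -1) - u := by linarith
  have e8 : (-1 : ℝ) ≠ 1 := by norm_num
  simp only [e1, e2, e3, e4, e5, e6, e7, e8, ne_eq]
  simp

/-! ### Redundancy of the minus subtype -/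

theorem mem_P3_of_kequiv {T₁ T₂ : Subtypes} {u v : ℝ} (h₁ : Admissible T₁ u)
    (h₂ : Admissible T₂ v) (h : KEquiv ℝ (NF T₁ u) (NF T₂ v)) :
    ((u : ℂ), (v : ℂ)) ∈ P3 T₁ T₂ :=
  ⟨u, v, rfl, h₁, h₂, h⟩

theorem exists_kequiv_plus_of_minus (a : ℝ) :
    ∃ a' : ℝ, Admissible .plus a' ∧ KEquiv ℝ (NF .minus a) (NF .plus a') := by
  have h : ((a : ℂ), f3 (-1) 1 a) ∈ P3 .minus .plus := by
    rw [P3_minus_plus]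
    -- Index `0` selects `f₃`, whose graph covers all of `ℝ`; membership in `P3` then supplies a
    -- real admissible value.
    exact ⟨⟨a, trivial, rfl⟩, 0, rfl⟩
  obtain ⟨u, v, hp, -, hv, h⟩ := h
  obtain rfl : a = u := Complex.ofReal_injective (congrArg Prod.fst hp)
  exact ⟨v, hv, h⟩

/-- At `a' = 0` the required root would satisfy `q² = -4`, and a pure scaling cannot change the sign
of the `x y⁴` term over `ℝ`. -/
theorem not_kequiv_plus_zero_minus (a : ℝ) : ¬ KEquiv ℝ (NF .plus 0) (NF .minus a) := by
  intro h
  have hp := (mem_P3_iff _ _ _).1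
    (mem_P3_of_kequiv (T₁ := .plus) (T₂ := .minus) (by simp [Admissible]) trivial h)
  obtain ⟨u, v, huv, -, ⟨h1, -⟩ | ⟨q, hq, -⟩⟩ := hp
  · norm_num [sgn] at h1
  · have hu : (0 : ℝ) = u := Complex.ofReal_injective (congrArg Prod.fst huv)
    simp only [sgn, ← hu] at hq
    nlinarith

end J10

theorem theorem6p2 :
    -- the pair (J₁₀⁺, J₁₀⁺), with ρ = 1 and σ = 1
    (P1 .plus .plus =
        jointGraph Cprime ![f1 1 1, f2 1 1, f3 1 1, f4 1 1, f5 1 1, f6 1 1] ∧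
      P2 .plus .plus =
        jointGraph (realSet Rprime) ![f1 1 1, f2 1 1]
          ∪ jointGraph (realSet (Set.Ioi 2)) ![f3 1 1, f4 1 1]
          ∪ jointGraph (realSet (Set.Iio (-2))) ![f5 1 1, f6 1 1]
          ∪ {((0 : ℂ), (((-xi : ℝ)) : ℂ)), ((0 : ℂ), (xi : ℂ))}
          ∪ {(((-xi : ℝ) : ℂ), (0 : ℂ)), ((xi : ℂ), (0 : ℂ))} ∧
      P3 .plus .plus =
        jointGraph (realSet Rprime) ![f1 1 1]
          ∪ jointGraph (realSet (Set.Ioi 2)) ![f4 1 1]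
          ∪ jointGraph (realSet (Set.Iio (-2))) ![f5 1 1]) ∧
    -- the pair (J₁₀⁻, J₁₀⁻), with ρ = -1 and σ = -1
    (P1 .minus .minus =
        jointGraph Set.univ ![f1 (-1) (-1), f2 (-1) (-1)]
          ∪ jointGraph Cpprime
              ![f3 (-1) (-1), f4 (-1) (-1), f5 (-1) (-1), f6 (-1) (-1)] ∧
      P2 .minus .minus = jointGraph (realSet Set.univ) ![f1 (-1) (-1), f2 (-1) (-1)] ∧
      P3 .minus .minus = jointGraph (realSet Set.univ) ![f1 (-1) (-1)]) ∧
    -- the pair (J₁₀⁺, J₁₀⁻), with ρ = 1 and σ = -1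
    (P1 .plus .minus =
        jointGraph Cprime
          ![f1 1 (-1), f2 1 (-1), f3 1 (-1), f4 1 (-1), f5 1 (-1), f6 1 (-1)] ∧
      P2 .plus .minus =
        {((0 : ℂ), (0 : ℂ))}
          ∪ jointGraph (realSet (Set.Ioi 2)) ![f3 1 (-1), f4 1 (-1)]
          ∪ jointGraph (realSet (Set.Iio (-2))) ![f5 1 (-1), f6 1 (-1)] ∧
      P3 .plus .minus =
        jointGraph (realSet I1) ![f3 1 (-1)]
          ∪ jointGraph (realSet I2) ![f4 1 (-1)]
          ∪ jointGraph (realSet I3) ![f5 1 (-1)]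
          ∪ jointGraph (realSet I4) ![f6 1 (-1)]
          ∪ {(((-xi : ℝ) : ℂ), (0 : ℂ)), ((xi : ℂ), (0 : ℂ))}) ∧
    -- the pair (J₁₀⁻, J₁₀⁺), with ρ = -1 and σ = 1
    (P1 .minus .plus =
        jointGraph Cpprime
          ![f1 (-1) 1, f2 (-1) 1, f3 (-1) 1, f4 (-1) 1, f5 (-1) 1, f6 (-1) 1] ∧
      P2 .minus .plus =
        {((0 : ℂ), (0 : ℂ))}
          ∪ jointGraph (realSet Set.univ) ![f3 (-1) 1, f4 (-1) 1, f5 (-1) 1, f6 (-1) 1] ∧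
      P3 .minus .plus = jointGraph (realSet Set.univ) ![f3 (-1) 1, f6 (-1) 1]) ∧
    -- the subtype J₁₀⁻ is redundant
    (∀ a : ℝ, Admissible .minus a →
      ∃ a' : ℝ, Admissible .plus a' ∧ KEquiv ℝ (NF .minus a) (NF .plus a')) ∧
    -- the subtype J₁₀⁺ is not redundant
    (∃ a' : ℝ, Admissible .plus a' ∧
      ∀ a : ℝ, Admissible .minus a → ¬ KEquiv ℝ (NF .plus a') (NF .minus a)) := by
  exact ⟨⟨P1_plus_plus, P2_plus_plus, P3_plus_plus⟩,
    ⟨P1_minus_minus, P2_minus_minus, P3_minus_minus⟩,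
    ⟨P1_plus_minus, P2_plus_minus, P3_plus_minus⟩,
    ⟨P1_minus_plus, P2_minus_plus, P3_minus_plus⟩,
    fun a _ => exists_kequiv_plus_of_minus a,
    0, by simp [Admissible], fun a _ => not_kequiv_plus_zero_minus a⟩
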